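/- Let $L\ge 2$ and consider the $2$D toric code on the $L\times L$ torus, with one spin on each of the $N=2L^2$ edges and Hamiltonian $H=-\sum_s \mathbf X_s-\sum_p\mathbf Z_p$ on $(\mathbb C^2)^{\otimes N}$, where $\mathbf X_s=\prod_{j\in s}\sigma^x_j$ for each node $s$ (product over the four edges at $s$) and $\mathbf Z_p=\prod_{j\in p}\sigma^z_j$ for each cell $p$ (product over the four edges of $p$). For $\beta>0$ put $\sigma_\beta=e^{-\beta H}/\operatorname{Tr}e^{-\beta H}$ and $\langle Y,X\rangle_{\sigma_\beta}=\operatorname{Tr}(Y^\dagger X\sigma_\beta)$. For a self-adjoint coupling operator $S$ let $\mathcal L_S$ be the Davies generator with Glauber rates, $$\mathcal L_S(X)=\sum_{\omega}\frac{2}{e^{\beta\omega}+1}\Big(S(\omega)^\dagger XS(\omega)-\tfrac12\{S(\omega)^\dagger S(\omega),X\}\Big),\qquad S(\omega)=\sum_{\lambda-\lambda'=\omega}P_\lambda SP_{\lambda'},$$ where $\omega$ runs over the differences of eigenvalues of $H$ and $P_\lambda$ are the spectral projections of $H$. Fix a layout: disjoint sets of edges "snake" and "comb" that together contain all but two of the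 edges, such that any two cells are connected by a chain of cells in which consecutive cells share an edge of the snake, and any two nodes are connected by a path of edges of the comb; and logical operators $\mathsf X_i=\prod_{j\in A_i}\sigma^x_j$, $\mathsf Z_i=\prod_{j\in C_i}\sigma^z_j$, $\mathsf Y_i=-\mathrm i\,\mathsf Z_i\mathsf X_i$ $(i=1,2)$, where $A_i$ is disjoint from the comb and meets every cell in an even number of edges, $C_i$ is disjoint from the snake and meets every node in an even number of edges, and $|A_i\cap C_k|$ is odd if and only if $i=k$. (Such layouts exist for every $L\ge2$.) Set $$\mathcal L_{\rm local}=\sum_{j\in\rm snake}\mathcal L_{\sigma^x_j}+\sum_{j\in\rm comb}\mathcal L_{\sigma^z_j},\qquad \mathcal L_{\rm global}=\sum_{i=1}^2(\mathcal L_{\mathsf X_i}+\mathcal L_{\mathsf Z_i}),\qquad \mathcal L^{\rm gapped}=\mathcal L_{\rm local}+\mathcal L_{\rm global},$$ $$\mathcal L_\beta=\sum_{j=1}^N\big(\mathcal L_{\sigma^x_j}+\mathcal L_{\sigma^y_j}+\mathcal L_{\sigma^z_j}\big)+\mathcal L_{\rm global}.$$ Let $\mathcal A_{\rm m}$ be the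 algebra generated by all $\mathbf Z_p$ and the $\sigma^x_j$, $j\in$ snake, let $\mathcal A_{\rm e}$ be the algebra generated by all $\mathbf X_s$ and the $\sigma^z_j$, $j\in$ comb, and for $B_i\in\{\mathbf 1,\mathsf X_i,\mathsf Y_i,\mathsf Z_i\}$ let $\mathcal B_{B_1,B_2}=\operatorname{span}\{B_1B_2\,a\,e: a\in\mathcal A_{\rm m},\,e\in\mathcal A_{\rm e}\}$. Write $\mathrm{Gap}(T)$ for the smallest positive eigenvalue of $T$. Then $\mathcal L_{\rm local}$ maps $\mathcal B_{\mathbf 1,\mathbf 1}$ to itself and $g:=\mathrm{Gap}(-\mathcal L_{\rm local}|_{\mathcal B_{\mathbf 1,\mathbf 1}})>0$ is well defined. For every constant $C$ there is a constant $c>0$ depending only on $C$ (not on $L$, $\beta$ or the layout) such that, whenever $g\le C$: 1. for all $B_1,B_2$ with $B_1\ne\mathbf 1$ or $B_2\ne\mathbf 1$, the block $\mathcal B_{B_1,B_2}$ is invariant under $\mathcal L^{\rm gapped}$ and $-\mathcal L^{\rm gapped}|_{\mathcal B_{B_1,B_2}}\succeq c\,g$ with respect to $\langle\cdot,\cdot\rangle_{\sigma_\beta}$;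 2. $\mathrm{Gap}(-\mathcal L_\beta)\ge c\,g$. -/

import Mathlib

open Matrix

/-! ### Davies generators with Glauber rates, Gibbs states, spectral gaps -/

section Davies

variable {n : Type*} [Fintype n] [DecidableEq n]

/-- The spectrum of a matrix (used for Hermitian `H`), as a finite set of reals. -/
noncomputable def specSet (H : Matrix n n ℂ) : Finset ℝ :=
  (Matrix.finite_real_spectrum (A := H)).toFinset

/-- The spectral projection `1_{l}(H)` of a Hermitian matrix onto its eigenspace for `l`. -/
noncomputable def eigenProj (H : Matrix n n ℂ) (l : ℝ) : Matrix n n ℂ :=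
  cfc (fun x : ℝ => if x = l then (1 : ℝ) else 0) H

/-- The Bohr frequencies of `H`: all differences of two eigenvalues. -/
noncomputable def bohrFreq (H : Matrix n n ℂ) : Finset ℝ :=
  (specSet H ×ˢ specSet H).image fun p => p.1 - p.2

/-- The jump operator `S(ω) = ∑_{l - l' = ω} P_l S P_{l'}`. -/
noncomputable def jumpOp (H S : Matrix n n ℂ) (ω : ℝ) : Matrix n n ℂ :=
  ∑ p ∈ (specSet H ×ˢ specSet H).filter (fun p => p.1 - p.2 = ω),
    eigenProj H p.1 * S * eigenProj H p.2

/-- The Glauber transition rate. -/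
noncomputable def glauberRate (β ω : ℝ) : ℝ := 2 / (Real.exp (β * ω) + 1)

/-- `X ↦ V† X V - ½ {V† V, X}`. -/
noncomputable def dissipator (V : Matrix n n ℂ) : Module.End ℂ (Matrix n n ℂ) :=
  LinearMap.mulLeft ℂ Vᴴ ∘ₗ LinearMap.mulRight ℂ V
    - (1 / 2 : ℂ) • (LinearMap.mulLeft ℂ (Vᴴ * V) + LinearMap.mulRight ℂ (Vᴴ * V))

/-- The Davies generator (Heisenberg picture) with a single coupling operator `S`. -/
noncomputable def davies (H : Matrix n n ℂ) (β : ℝ) (S : Matrix n n ℂ) :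
    Module.End ℂ (Matrix n n ℂ) :=
  ∑ ω ∈ bohrFreq H, (glauberRate β ω : ℂ) • dissipator (jumpOp H S ω)

/-- The thermal state `exp(-βH) / Tr exp(-βH)`. -/
noncomputable def gibbsState (H : Matrix n n ℂ) (β : ℝ) : Matrix n n ℂ :=
  (NormedSpace.exp (-(β : ℂ) • H)).trace⁻¹ • NormedSpace.exp (-(β : ℂ) • H)

/-- The GNS inner product `⟨Y, X⟩ = Tr(Y† X σ)`. -/
noncomputable def gnsInner (σ Y X : Matrix n n ℂ) : ℂ := (Yᴴ * X * σ).trace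

/-- The positive eigenvalues of the restriction of `T` to the (`T`-invariant) subspace `W`. -/
def posEigenvalues {V : Type*} [AddCommGroup V] [Module ℂ V] (T : Module.End ℂ V)
    (W : Submodule ℂ V) : Set ℝ :=
  {r | 0 < r ∧ ∃ x ∈ W, x ≠ 0 ∧ T x = (r : ℂ) • x}

/-- The spectral gap of `T|_W`: the smallest positive eigenvalue. -/
noncomputable def gapOn {V : Type*} [AddCommGroup V] [Module ℂ V] (T : Module.End ℂ V)
    (W : Submodule ℂ V) : ℝ :=
  sInf (posEigenvalues T W)

/-- `T|_W ⪰ c` for the GNS inner product of `σ`: the subspace `W` is `T`-invariant, and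
`⟨A, (T - c) A⟩` is real and nonnegative for every `A ∈ W`. -/
def BoundedBelowOn (σ : Matrix n n ℂ) (T : Module.End ℂ (Matrix n n ℂ))
    (W : Submodule ℂ (Matrix n n ℂ)) (c : ℝ) : Prop :=
  (∀ A ∈ W, T A ∈ W) ∧
    ∀ A ∈ W, 0 ≤ (gnsInner σ A (T A - (c : ℂ) • A)).re ∧
      (gnsInner σ A (T A - (c : ℂ) • A)).im = 0

end Davies

/-! ### The toric code on the `L × L` torus -/

namespace Toric

/-- Nodes of the lattice; the cell with lower left corner `p` is also denoted by `p`. -/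
abbrev Node (L : ℕ) : Type := ZMod L × ZMod L

/-- Edges: `inl v` is the edge from `v` to `v + (1, 0)`, `inr v` the one from `v` to
`v + (0, 1)`.  There is one spin on each of the `N = 2 L²` edges. -/
abbrev Edge (L : ℕ) : Type := Node L ⊕ Node L

/-- The four edges at a node. -/
def star {L : ℕ} (s : Node L) : Finset (Edge L) :=
  {Sum.inl s, Sum.inl (s - (1, 0)), Sum.inr s, Sum.inr (s - (0, 1))}

/-- The four edges around a cell. -/
def plaq {L : ℕ} (p : Node L) : Finset (Edge L) :=
  {Sum.inl p, Sum.inl (p + (0, 1)), Sum.inr p, Sum.inr (p + (1, 0))}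

/-- Labels of the computational basis of `(ℂ²)^{⊗ N}`. -/
abbrev Cfg (L : ℕ) : Type := Edge L → Fin 2

/-- Operators on the space of `N` spins. -/
abbrev Op (L : ℕ) : Type := Matrix (Cfg L) (Cfg L) ℂ

/-- The Pauli matrix `σˣ`. -/
def pauliX : Matrix (Fin 2) (Fin 2) ℂ := !![0, 1; 1, 0]

/-- The Pauli matrix `σʸ`. -/
def pauliY : Matrix (Fin 2) (Fin 2) ℂ := !![0, -Complex.I; Complex.I, 0]

/-- The Pauli matrix `σᶻ`. -/
def pauliZ : Matrix (Fin 2) (Fin 2) ℂ := !![1, 0; 0, -1]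

variable {L : ℕ} [NeZero L]

/-- `∏_{j ∈ A} M_j`: the tensor product over all edges of `M` on the edges in `A` and of the
identity on the others. -/
def onSites (A : Finset (Edge L)) (M : Matrix (Fin 2) (Fin 2) ℂ) : Op L :=
  fun s t => ∏ k, (if k ∈ A then M else 1) (s k) (t k)

variable (L) in
/-- The toric code Hamiltonian `-∑_s X_s - ∑_p Z_p`. -/
def hamiltonian : Op L :=
  -(∑ s : Node L, onSites (star s) pauliX) - (∑ p : Node L, onSites (plaq p) pauliZ)

/-- The graph on nodes (with `nbhd = star`) or on cells (with `nbhd = plaq`) in which two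
different ones are adjacent if they share an edge of the lattice that lies in `K`. -/
def linkGraph (nbhd : Node L → Finset (Edge L)) (K : Finset (Edge L)) : SimpleGraph (Node L) :=
  SimpleGraph.fromRel fun s t => ∃ j ∈ K, j ∈ nbhd s ∧ j ∈ nbhd t

variable (L) in
/-- A snake, a comb and the supports of the logical operators.  The snake connects all cells, the
comb connects all nodes, and together they partition all but two of the spins.  Products of `σˣ`
over `loopX i` commute with all plaquette terms and avoid the comb; products of `σᶻ` over
`loopZ i` commute with all star terms and avoid the snake; and the two pairs generate two
commuting Pauli algebras. -/
structure Layout where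
  snake : Finset (Edge L)
  comb : Finset (Edge L)
  loopX : Fin 2 → Finset (Edge L)
  loopZ : Fin 2 → Finset (Edge L)
  snake_connected : (linkGraph plaq snake).Connected
  comb_connected : (linkGraph star comb).Connected
  disjoint_snake_comb : Disjoint snake comb
  card_rest : (snake ∪ comb)ᶜ.card = 2
  disjoint_loopX : ∀ i, Disjoint (loopX i) comb
  disjoint_loopZ : ∀ i, Disjoint (loopZ i) snake
  even_loopX : ∀ i p, Even (loopX i ∩ plaq p).card
  even_loopZ : ∀ i s, Even (loopZ i ∩ star s).card
  odd_inter : ∀ i k, Odd (loopX i ∩ loopZ k).card ↔ i = k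

/-! ### A standard layout

The snake runs along the first column and the first row of cells, and then row by row, in
alternating directions, through the remaining cells.  The logical operators are the four straight
loops through the two edges at the origin that are neither on the snake nor on the comb. -/

section Standard

set_option linter.unusedSectionVars false
set_option linter.unnecessarySeqFocus false

theorem zmod_up (P : ZMod L → Prop) (h0 : P 0) (hs : ∀ x, x + 1 ≠ 0 → P x → P (x + 1)) :
    ∀ x, P x := by
  have key : ∀ k : ℕ, P (k : ZMod L) := by
    intro k
    induction k with
    | zero => simpa using h0
    | succ k ih =>
      push_cast
      by_cases h : (k : ZMod L) + 1 = 0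
      · rw [h]; exact h0
      · exact hs _ h ih
  intro x
  have := key x.val
  rwa [ZMod.natCast_zmod_val] at this

theorem zmod_down (P : ZMod L → Prop) (h0 : P 0) (hs : ∀ x, x ≠ 0 → P (x + 1) → P x) :
    ∀ x, P x := by
  have key := zmod_up (fun x => P (-x)) (by simpa using h0) (by
    intro x hx h
    refine hs _ (neg_ne_zero.mpr hx) ?_
    have e : -(x + 1) + 1 = -x := by ring
    rw [e]; exact h)
  intro x
  simpa using key (-x)

/-- The column in which the snake passes from row `y - 1` to row `y`, besides column `0`. -/
def passCol (y : ZMod L) : ZMod L := if Odd y.val then -1 else 1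

variable (L) in
/-- The standard snake. -/
def stdSnake : Finset (Edge L) :=
  (Finset.univ.filter fun v : Node L => v.2 ≠ 0 ∧ (v.1 = 0 ∨ v.1 = passCol v.2)).disjSum
    (Finset.univ.filter fun v : Node L => v.1 ≠ 0 ∧ (v.2 = 0 ∨ v.1 ≠ 1))

variable (L) in
/-- The standard comb. -/
def stdComb : Finset (Edge L) :=
  (Finset.univ.filter fun v : Node L => v.1 ≠ 0 ∧ (v.2 = 0 ∨ v.1 ≠ passCol v.2)).disjSum
    (Finset.univ.filter fun v : Node L => v.2 ≠ 0 ∧ (v.1 = 0 ∨ v.1 = 1))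

variable (L) in
/-- The supports of the standard logical operators `X_1, X_2`. -/
def stdLoopX (i : Fin 2) : Finset (Edge L) :=
  (Finset.univ.filter fun v : Node L => i = 0 ∧ v.1 = 0).disjSum
    (Finset.univ.filter fun v : Node L => i = 1 ∧ v.2 = 0)

variable (L) in
/-- The supports of the standard logical operators `Z_1, Z_2`. -/
def stdLoopZ (i : Fin 2) : Finset (Edge L) :=
  (Finset.univ.filter fun v : Node L => i = 0 ∧ v.2 = 0).disjSum
    (Finset.univ.filter fun v : Node L => i = 1 ∧ v.1 = 0)

theorem linkGraph_reach {nbhd : Node L → Finset (Edge L)} {K : Finset (Edge L)} {s t : Node L}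
    (j : Edge L) (hj : j ∈ K) (hs : j ∈ nbhd s) (ht : j ∈ nbhd t) :
    (linkGraph nbhd K).Reachable s t := by
  by_cases h : s = t
  · rw [h]
  · refine SimpleGraph.Adj.reachable ?_
    rw [linkGraph, SimpleGraph.fromRel_adj]
    exact ⟨h, Or.inl ⟨j, hj, hs, ht⟩⟩

theorem passCol_ne_zero (hL : 2 ≤ L) (y : ZMod L) : passCol y ≠ 0 := by
  have : Fact (1 < L) := ⟨hL⟩
  unfold passCol
  split_ifs <;> simp

theorem stdSnake_connected (hL : 2 ≤ L) : (linkGraph plaq (stdSnake L)).Connected := by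
  have : Fact (1 < L) := ⟨hL⟩
  have col : ∀ y : ZMod L, (linkGraph plaq (stdSnake L)).Reachable (0, 0) (0, y) := by
    refine zmod_up _ (SimpleGraph.Reachable.refl _) ?_
    intro y hy h
    exact h.trans (linkGraph_reach (.inl (0, y + 1)) (by simp [stdSnake, hy])
      (by simp [plaq]) (by simp [plaq]))
  have row : ∀ x : ZMod L, (linkGraph plaq (stdSnake L)).Reachable (0, 0) (x, 0) := by
    refine zmod_up _ (SimpleGraph.Reachable.refl _) ?_
    intro x hx h
    exact h.trans (linkGraph_reach (.inr (x + 1, 0)) (by simp [stdSnake, hx])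
      (by simp [plaq]) (by simp [plaq]))
  have rows : ∀ y x : ZMod L,
      x = 0 ∨ (linkGraph plaq (stdSnake L)).Reachable (1, y) (x, y) := by
    intro y
    refine zmod_up _ (Or.inl rfl) ?_
    intro x hx h
    right
    by_cases h0 : x = 0
    · subst h0; rw [zero_add]
    · refine (h.resolve_left h0).trans (linkGraph_reach (.inr (x + 1, y)) ?_
        (by simp [plaq]) (by simp [plaq]))
      simp [stdSnake, hx, h0]
  have one : ∀ y : ZMod L, (linkGraph plaq (stdSnake L)).Reachable (0, 0) (1, y) := by
    refine zmod_up _ (row 1) ?_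
    intro y hy h
    have h1 := (rows y (passCol (y + 1))).resolve_left (passCol_ne_zero hL _)
    have h2 := (rows (y + 1) (passCol (y + 1))).resolve_left (passCol_ne_zero hL _)
    refine (h.trans h1).trans (SimpleGraph.Reachable.trans ?_ h2.symm)
    exact linkGraph_reach (.inl (passCol (y + 1), y + 1)) (by simp [stdSnake, hy])
      (by simp [plaq]) (by simp [plaq])
  have all : ∀ p : Node L, (linkGraph plaq (stdSnake L)).Reachable (0, 0) p := by
    rintro ⟨x, y⟩
    by_cases h0 : x = 0
    · rw [h0]; exact col y
    · exact (one y).trans ((rows y x).resolve_left h0)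
  exact { preconnected := fun p q => (all p).symm.trans (all q), nonempty := ⟨(0, 0)⟩ }

theorem stdComb_connected (hL : 2 ≤ L) : (linkGraph star (stdComb L)).Connected := by
  have : Fact (1 < L) := ⟨hL⟩
  have row : ∀ x : ZMod L, (linkGraph star (stdComb L)).Reachable (0, 0) (x, 0) := by
    refine zmod_down _ (SimpleGraph.Reachable.refl _) ?_
    intro x hx h
    exact h.trans (linkGraph_reach (.inl (x, 0)) (by simp [stdComb, hx])
      (by simp [star]) (by simp [star]))
  have col0 : ∀ y : ZMod L, (linkGraph star (stdComb L)).Reachable (0, 0) (0, y) := by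
    refine zmod_down _ (SimpleGraph.Reachable.refl _) ?_
    intro y hy h
    exact h.trans (linkGraph_reach (.inr (0, y)) (by simp [stdComb, hy])
      (by simp [star]) (by simp [star]))
  have col1 : ∀ y : ZMod L, (linkGraph star (stdComb L)).Reachable (0, 0) (1, y) := by
    refine zmod_down _ (row 1) ?_
    intro y hy h
    exact h.trans (linkGraph_reach (.inr (1, y)) (by simp [stdComb, hy])
      (by simp [star]) (by simp [star]))
  have all : ∀ y x : ZMod L, (linkGraph star (stdComb L)).Reachable (0, 0) (x, y) := by
    intro y
    by_cases hp : Odd y.val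
    · have : ∀ x : ZMod L, (linkGraph star (stdComb L)).Reachable (0, 0) (x, y) := by
        refine zmod_up _ (col0 y) ?_
        intro x hx h
        by_cases h0 : x = 0
        · subst h0; rw [zero_add]; exact col1 y
        · refine h.trans (linkGraph_reach (.inl (x, y)) ?_ (by simp [star]) (by simp [star]))
          have hx' : x ≠ -1 := fun h => hx (by rw [h]; ring)
          have hc : x ≠ passCol y := by simpa [passCol, hp] using hx'
          simp [stdComb, h0, hc]
      exact this
    · refine zmod_down _ (col0 y) ?_
      intro x hx h
      by_cases h1 : x = 1
      · rw [h1]; exact col1 y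
      · refine h.trans (linkGraph_reach (.inl (x, y)) ?_ (by simp [star]) (by simp [star]))
        have hc : x ≠ passCol y := by simpa [passCol, hp] using h1
        simp [stdComb, hx, hc]
  exact { preconnected := fun p q => (all p.2 p.1).symm.trans (all q.2 q.1),
          nonempty := ⟨(0, 0)⟩ }

theorem even_card_of_pair {A B : Finset (Edge L)} {a b : Edge L} (hab : a ≠ b)
    (P : Prop) (h : ∀ j, j ∈ A ∩ B ↔ P ∧ (j = a ∨ j = b)) : Even (A ∩ B).card := by
  by_cases hP : P
  · have : A ∩ B = {a, b} := by ext j; rw [h]; simp [hP]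
    rw [this, Finset.card_pair hab]; exact even_two
  · have : A ∩ B = ∅ := by
      ext j; rw [h]; simp [hP]
    rw [this]; simp

/-- The standard layout. -/
def stdLayout (hL : 2 ≤ L) : Layout L where
  snake := stdSnake L
  comb := stdComb L
  loopX := stdLoopX L
  loopZ := stdLoopZ L
  snake_connected := stdSnake_connected hL
  comb_connected := stdComb_connected hL
  disjoint_snake_comb := by
    rw [Finset.disjoint_left]
    rintro (⟨x, y⟩ | ⟨x, y⟩) h1 h2 <;>
      simp only [stdSnake, stdComb, Finset.mem_filter, Finset.mem_univ, true_and, Finset.inl_mem_disjSum, Finset.inr_mem_disjSum] at h1 h2 <;> tauto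
  card_rest := by
    have : (stdSnake L ∪ stdComb L)ᶜ = {.inl (0, 0), .inr (0, 0)} := by
      ext j
      rcases j with ⟨x, y⟩ | ⟨x, y⟩ <;>
        simp only [stdSnake, stdComb, Finset.mem_compl, Finset.mem_union, Finset.mem_filter,
          Finset.mem_univ, true_and, Finset.inl_mem_disjSum, Finset.inr_mem_disjSum, Finset.mem_insert, Finset.mem_singleton, Sum.inl.injEq,
          Sum.inr.injEq, Prod.mk.injEq, reduceCtorEq, or_false, false_or] <;> tauto
    rw [this]
    exact Finset.card_pair (by simp)
  disjoint_loopX := by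
    intro i
    rw [Finset.disjoint_left]
    rintro (⟨x, y⟩ | ⟨x, y⟩) h1 h2 <;>
      simp only [stdLoopX, stdComb, Finset.mem_filter, Finset.mem_univ, true_and, Finset.inl_mem_disjSum, Finset.inr_mem_disjSum] at h1 h2 <;> tauto
  disjoint_loopZ := by
    intro i
    rw [Finset.disjoint_left]
    rintro (⟨x, y⟩ | ⟨x, y⟩) h1 h2 <;>
      simp only [stdLoopZ, stdSnake, Finset.mem_filter, Finset.mem_univ, true_and, Finset.inl_mem_disjSum, Finset.inr_mem_disjSum] at h1 h2 <;> tauto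
  even_loopX := by
    have : Fact (1 < L) := ⟨hL⟩
    rintro i ⟨a, b⟩
    fin_cases i
    · refine even_card_of_pair (a := .inl (a, b)) (b := .inl (a, b + 1)) (by simp) (a = 0) ?_
      rintro (⟨x, y⟩ | ⟨x, y⟩) <;> simp [stdLoopX, plaq] <;> grind
    · refine even_card_of_pair (a := .inr (a, b)) (b := .inr (a + 1, b)) (by simp) (b = 0) ?_
      rintro (⟨x, y⟩ | ⟨x, y⟩) <;> simp [stdLoopX, plaq] <;> grind
  even_loopZ := by
    have : Fact (1 < L) := ⟨hL⟩
    rintro i ⟨a, b⟩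
    fin_cases i
    · refine even_card_of_pair (a := .inl (a, b)) (b := .inl (a - 1, b)) (by simp [eq_sub_iff_add_eq]) (b = 0) ?_
      rintro (⟨x, y⟩ | ⟨x, y⟩) <;> simp [stdLoopZ, star] <;> grind
    · refine even_card_of_pair (a := .inr (a, b)) (b := .inr (a, b - 1)) (by simp [eq_sub_iff_add_eq]) (a = 0) ?_
      rintro (⟨x, y⟩ | ⟨x, y⟩) <;> simp [stdLoopZ, star] <;> grind
  odd_inter := by
    have h00 : stdLoopX L 0 ∩ stdLoopZ L 0 = {.inl (0, 0)} := by
      ext j; rcases j with ⟨x, y⟩ | ⟨x, y⟩ <;> simp [stdLoopX, stdLoopZ]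
    have h01 : stdLoopX L 0 ∩ stdLoopZ L 1 = ∅ := by
      ext j; rcases j with ⟨x, y⟩ | ⟨x, y⟩ <;> simp [stdLoopX, stdLoopZ]
    have h10 : stdLoopX L 1 ∩ stdLoopZ L 0 = ∅ := by
      ext j; rcases j with ⟨x, y⟩ | ⟨x, y⟩ <;> simp [stdLoopX, stdLoopZ]
    have h11 : stdLoopX L 1 ∩ stdLoopZ L 1 = {.inr (0, 0)} := by
      ext j; rcases j with ⟨x, y⟩ | ⟨x, y⟩ <;> simp [stdLoopX, stdLoopZ, and_comm]
    intro i k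
    fin_cases i <;> fin_cases k <;> simp [h00, h01, h10, h11]

end Standard

/-- Labels of the four elements of a Pauli basis. -/
inductive Label
  | I
  | X
  | Y
  | Z

namespace Layout

variable (D : Layout L) (β : ℝ)

/-- The logical operator `X_i`. -/
def logX (i : Fin 2) : Op L := onSites (D.loopX i) pauliX

/-- The logical operator `Z_i`. -/
def logZ (i : Fin 2) : Op L := onSites (D.loopZ i) pauliZ

/-- The logical operators `1, X_i, Y_i = -i Z_i X_i, Z_i`. -/
noncomputable def logOp (i : Fin 2) : Label → Op L
  | .I => 1
  | .X => D.logX i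
  | .Y => -Complex.I • (D.logZ i * D.logX i)
  | .Z => D.logZ i

/-- The magnetic syndrome algebra, generated by all `Z_p` and by `σˣ_j` for `j` in the snake. -/
def algM : Subalgebra ℂ (Op L) :=
  Algebra.adjoin ℂ (Set.range (fun p : Node L => onSites (plaq p) pauliZ) ∪
    (fun j => onSites {j} pauliX) '' (D.snake : Set (Edge L)))

/-- The electric syndrome algebra, generated by all `X_s` and by `σᶻ_j` for `j` in the comb. -/
def algE : Subalgebra ℂ (Op L) :=
  Algebra.adjoin ℂ (Set.range (fun s : Node L => onSites (star s) pauliX) ∪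
    (fun j => onSites {j} pauliZ) '' (D.comb : Set (Edge L)))

/-- The block `B₁ ⊗ B₂ ⊗ A_m ⊗ A_e`, where `⊗` is the product of commuting matrices: the linear
span of all `B₁ B₂ a e` with `a ∈ A_m` and `e ∈ A_e`. -/
noncomputable def block (B₁ B₂ : Label) : Submodule ℂ (Op L) :=
  Submodule.span ℂ {T | ∃ a ∈ D.algM, ∃ e ∈ D.algE, T = D.logOp 0 B₁ * D.logOp 1 B₂ * (a * e)}

/-- `∑_{j ∈ snake} L_{σˣ_j} + ∑_{j ∈ comb} L_{σᶻ_j}`. -/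
noncomputable def genLocal : Module.End ℂ (Op L) :=
  (∑ j ∈ D.snake, davies (hamiltonian L) β (onSites {j} pauliX))
    + (∑ j ∈ D.comb, davies (hamiltonian L) β (onSites {j} pauliZ))

/-- `L_{X_1} + L_{Z_1} + L_{X_2} + L_{Z_2}` for the logical operators. -/
noncomputable def genGlobal : Module.End ℂ (Op L) :=
  ∑ i : Fin 2, (davies (hamiltonian L) β (D.logX i) + davies (hamiltonian L) β (D.logZ i))

/-- The sum of the snake-and-comb generator and of the global one. -/
noncomputable def genGapped : Module.End ℂ (Op L) := D.genLocal β + D.genGlobal β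

/-- The Gibbs sampler: all single-site Pauli couplings and the four global ones. -/
noncomputable def genFull : Module.End ℂ (Op L) :=
  (∑ j : Edge L, (davies (hamiltonian L) β (onSites {j} pauliX)
      + davies (hamiltonian L) β (onSites {j} pauliY)
      + davies (hamiltonian L) β (onSites {j} pauliZ)))
    + D.genGlobal β

end Layout

end Toric

set_option linter.unusedSectionVars false

/-! ### Davies generators: spectral calculus, detailed balance and the Dirichlet form. -/

section Davies

variable {n : Type*} [Fintype n] [DecidableEq n]

/-! Detailed balance makes `-davies H β S` symmetric and nonnegative for the GNS product when `S` is
Hermitian, with Dirichlet form `½ ∑ rate(ω) ‖[S(ω), A]‖²` (`gnsInner_davies`). Hence the forms of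
several couplings add, and more couplings only raise the form.

A logical operator `U` commutes with `H` and squares to one, so its generator is `A ↦ U A U - A`,
and its negative acts as `2` on operators with `U A U = -A`. An element of a nontrivial block is `b
Q`, where `Q` commutes with all logical operators and some logical operator, depending only on the
block, anticommutes with `b`. The global part alone therefore gives the lower bound `2` there.

For the Gibbs sampler, let `x` be an eigenvector with eigenvalue `r > 0`. Every coupling commutes or
anticommutes with every logical `U`, and the dissipator is quadratic in the coupling, so the
generator commutes with `A ↦ U A U` (`genFull_conj`). If some `U` does not fix `x`, then `x - U x U`
is an eigenvector for the same `r` and is odd under `U`, whence `r ≥ 2`. Otherwise `x` lies in the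
trivial block, which is the commutant of the logical operators (`mem_block_of_commute`). There `x`
is orthogonal to the identity, the kernel of the local generator consists of scalars
(`eq_smul_one_of_genLocal_eq_zero`), and the form of the sampler dominates the local one, so `r ≥
g`. Finally `g ≤ C` turns the bound `2` into a multiple of `g`.

The geometry enters twice. A rank count over `ZMod 2` (`span_eq_top`) shows that snake, stars and
`X` loops generate all products of `σˣ`, and dually for `σᶻ`. And an operator of zero local
Dirichlet form commutes with `S` and `[H, S]` for each local coupling; connectedness extracts from
these commutators every single plaquette and star operator (`commute_node_of_connected`), so on the
trivial block only scalars remain. -/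

theorem exp_smul_eq_cfc {H : Matrix n n ℂ} (hH : H.IsHermitian) (t : ℝ) :
    NormedSpace.exp ((t : ℂ) • H) = cfc (fun x : ℝ => Real.exp (t * x)) H := by
  have hU : IsUnit (hH.eigenvectorUnitary : Matrix n n ℂ) :=
    (Unitary.toUnits hH.eigenvectorUnitary).isUnit
  have hi : (hH.eigenvectorUnitary : Matrix n n ℂ)⁻¹ = star (hH.eigenvectorUnitary : Matrix n n ℂ) :=
    Matrix.inv_eq_right_inv (Unitary.coe_mul_star_self _)
  rw [hH.cfc_eq, Matrix.IsHermitian.cfc, Unitary.conjStarAlgAut_apply]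
  nth_rw 1 [hH.spectral_theorem]
  rw [Unitary.conjStarAlgAut_apply, ← hi, ← smul_mul_assoc, ← mul_smul_comm,
    Matrix.exp_conj _ _ hU, ← Matrix.diagonal_smul, Matrix.exp_diagonal]
  congr 3
  ext i
  simp [NormedSpace.exp, Complex.exp_eq_exp_ℂ]

theorem continuousOn_spectrum (H : Matrix n n ℂ) (f : ℝ → ℝ) : ContinuousOn f (spectrum ℝ H) :=
  (Matrix.finite_real_spectrum (A := H)).continuousOn f

theorem isHermitian_eigenProj (H : Matrix n n ℂ) (l : ℝ) : (eigenProj H l).IsHermitian :=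
  cfc_predicate (p := IsSelfAdjoint) _ _

theorem cfc_mul_eigenProj {H : Matrix n n ℂ} (f : ℝ → ℝ) (l : ℝ) :
    cfc f H * eigenProj H l = (f l : ℂ) • eigenProj H l := by
  rw [eigenProj, ← cfc_mul f _ H (continuousOn_spectrum H _) (continuousOn_spectrum H _)]
  rw [Complex.coe_smul, ← cfc_smul _ _ _ (continuousOn_spectrum H _)]
  congr 1
  ext x
  by_cases h : x = l <;> simp [h]

theorem eigenProj_mul_cfc {H : Matrix n n ℂ} (f : ℝ → ℝ) (l : ℝ) :
    eigenProj H l * cfc f H = (f l : ℂ) • eigenProj H l := by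
  rw [← cfc_mul_eigenProj]
  exact cfc_commute_cfc _ _ _

theorem mul_eigenProj {H : Matrix n n ℂ} (hH : H.IsHermitian) (l : ℝ) :
    H * eigenProj H l = (l : ℂ) • eigenProj H l := by
  have h := cfc_mul_eigenProj (H := H) (fun x => x) l
  have e : cfc (fun x : ℝ => x) H = H := cfc_id' ℝ H hH
  rwa [e] at h

theorem eigenProj_mul {H : Matrix n n ℂ} (hH : H.IsHermitian) (l : ℝ) :
    eigenProj H l * H = (l : ℂ) • eigenProj H l := by
  have h := eigenProj_mul_cfc (H := H) (fun x => x) l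
  have e : cfc (fun x : ℝ => x) H = H := cfc_id' ℝ H hH
  rwa [e] at h

theorem eigenProj_mul_eigenProj_of_ne (H : Matrix n n ℂ) {l m : ℝ} (h : l ≠ m) :
    eigenProj H l * eigenProj H m = 0 := by
  have := cfc_mul_eigenProj (H := H) (fun x => if x = l then 1 else 0) m
  simpa [eigenProj, h.symm] using this

theorem sum_eigenProj {H : Matrix n n ℂ} (hH : H.IsHermitian) :
    ∑ l ∈ specSet H, eigenProj H l = 1 := by
  have hs : IsSelfAdjoint H := hH
  unfold eigenProj
  rw [← cfc_sum _ _ _ (fun l _ => continuousOn_spectrum H _), ← cfc_one ℝ H]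
  refine cfc_congr fun x hx => ?_
  have : x ∈ specSet H := by simpa [specSet] using hx
  simp [Finset.sum_apply, this]

theorem neg_mem_bohrFreq {H : Matrix n n ℂ} {ω : ℝ} (h : ω ∈ bohrFreq H) : -ω ∈ bohrFreq H := by
  simp only [bohrFreq, Finset.mem_image, Finset.mem_product, Prod.exists] at h ⊢
  obtain ⟨a, b, ⟨ha, hb⟩, rfl⟩ := h
  exact ⟨b, a, ⟨hb, ha⟩, by ring⟩

/-- Pairs of eigenvalues are grouped by their difference. The weights `1` and `ω` then recover `S`
and `[H, S]` from the jump operators. -/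
theorem sum_bohrFreq_smul_jumpOp (H S : Matrix n n ℂ) (f : ℝ → ℂ) :
    ∑ ω ∈ bohrFreq H, f ω • jumpOp H S ω = ∑ p ∈ specSet H ×ˢ specSet H,
      f (p.1 - p.2) • (eigenProj H p.1 * S * eigenProj H p.2) := by
  rw [← Finset.sum_fiberwise_of_maps_to (s := specSet H ×ˢ specSet H) (t := bohrFreq H)
    (g := fun p => p.1 - p.2) (fun p hp => Finset.mem_image_of_mem _ hp)]
  refine Finset.sum_congr rfl fun ω _ => ?_
  rw [jumpOp, Finset.smul_sum]
  refine Finset.sum_congr rfl fun p hp => ?_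
  rw [(Finset.mem_filter.1 hp).2]

theorem sum_jumpOp {H : Matrix n n ℂ} (hH : H.IsHermitian) (S : Matrix n n ℂ) :
    ∑ ω ∈ bohrFreq H, jumpOp H S ω = S := by
  have h := sum_bohrFreq_smul_jumpOp H S (fun _ => 1)
  simp only [one_smul] at h
  rw [h, Finset.sum_product]
  simp_rw [← Finset.mul_sum, sum_eigenProj hH, mul_one, ← Finset.sum_mul, sum_eigenProj hH,
    one_mul]

theorem sum_freq_smul_jumpOp {H : Matrix n n ℂ} (hH : H.IsHermitian) (S : Matrix n n ℂ) :
    ∑ ω ∈ bohrFreq H, (ω : ℂ) • jumpOp H S ω = H * S - S * H := by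
  rw [sum_bohrFreq_smul_jumpOp H S (fun ω => (ω : ℂ))]
  have h := congrArg (fun T => H * T - T * H) (sum_bohrFreq_smul_jumpOp H S (fun _ => 1))
  simp only [one_smul, sum_jumpOp hH] at h
  rw [h, Finset.mul_sum, Finset.sum_mul, ← Finset.sum_sub_distrib]
  refine Finset.sum_congr rfl fun p _ => ?_
  rw [← mul_assoc, ← mul_assoc, mul_eigenProj hH, mul_assoc _ _ H, eigenProj_mul hH]
  push_cast
  simp [sub_smul]

theorem conjTranspose_jumpOp {H S : Matrix n n ℂ} (hS : S.IsHermitian) (ω : ℝ) :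
    (jumpOp H S ω)ᴴ = jumpOp H S (-ω) := by
  rw [jumpOp, jumpOp, conjTranspose_sum]
  refine Finset.sum_nbij' (fun p => (p.2, p.1)) (fun p => (p.2, p.1)) ?_ ?_ ?_ ?_ ?_
  · simp only [Finset.mem_filter, Finset.mem_product]
    rintro p ⟨⟨h1, h2⟩, h3⟩
    exact ⟨⟨h2, h1⟩, by rw [← h3]; ring⟩
  · simp only [Finset.mem_filter, Finset.mem_product]
    rintro p ⟨⟨h1, h2⟩, h3⟩
    exact ⟨⟨h2, h1⟩, by rw [← neg_inj, ← h3]; ring⟩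
  · simp
  · simp
  · intro p _
    simp only [conjTranspose_mul, (isHermitian_eigenProj H _).eq, hS.eq, mul_assoc]

theorem gibbsState_mul_eigenProj {H : Matrix n n ℂ} (hH : H.IsHermitian) (β l : ℝ) :
    gibbsState H β * eigenProj H l =
      ((NormedSpace.exp (-(β : ℂ) • H)).trace⁻¹ * (Real.exp (-β * l) : ℂ)) • eigenProj H l := by
  have := exp_smul_eq_cfc hH (-β)
  rw [Complex.ofReal_neg] at this
  rw [gibbsState, smul_mul_assoc, this, cfc_mul_eigenProj, smul_smul]

theorem eigenProj_mul_gibbsState {H : Matrix n n ℂ} (hH : H.IsHermitian) (β l : ℝ) :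
    eigenProj H l * gibbsState H β =
      ((NormedSpace.exp (-(β : ℂ) • H)).trace⁻¹ * (Real.exp (-β * l) : ℂ)) • eigenProj H l := by
  have := exp_smul_eq_cfc hH (-β)
  rw [Complex.ofReal_neg] at this
  rw [gibbsState, mul_smul_comm, this, eigenProj_mul_cfc, smul_smul]

/-- A jump raises the energy by `ω`, so the Gibbs weights on its two sides differ by the factor `exp
(β ω)`. -/
theorem jumpOp_mul_gibbsState {H : Matrix n n ℂ} (hH : H.IsHermitian) (S : Matrix n n ℂ)
    (β ω : ℝ) : jumpOp H S ω * gibbsState H β =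
      (Real.exp (β * ω) : ℂ) • (gibbsState H β * jumpOp H S ω) := by
  rw [jumpOp, Finset.sum_mul, Finset.mul_sum, Finset.smul_sum]
  refine Finset.sum_congr rfl fun p hp => ?_
  rw [mul_assoc, eigenProj_mul_gibbsState hH, ← mul_assoc (gibbsState H β), ← mul_assoc (gibbsState H β),
    gibbsState_mul_eigenProj hH, mul_smul_comm, smul_mul_assoc, smul_mul_assoc, smul_smul,
    ← (Finset.mem_filter.1 hp).2, mul_left_comm, ← Complex.ofReal_mul, ← Real.exp_add]
  congr 4
  ring

-- The root is `exp (-β H / 2)` divided by the square root of the partition function. It turns the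
-- GNS product into the Hilbert-Schmidt product of `Y R` and `X R`; invertibility of `R` gives
-- definiteness.
open scoped ComplexOrder in
theorem exists_gibbsState_eq_mul_self [Nonempty n] {H : Matrix n n ℂ} (hH : H.IsHermitian)
    (β : ℝ) : ∃ R : Matrix n n ℂ, R.IsHermitian ∧ IsUnit R ∧ gibbsState H β = R * R := by
  set Q : Matrix n n ℂ := cfc (fun x : ℝ => Real.exp (-(β / 2) * x)) H with hQ
  have hQh : Q.IsHermitian := cfc_predicate (p := IsSelfAdjoint) _ _
  have hK : NormedSpace.exp (-(β : ℂ) • H) = Q * Q := by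
    have := exp_smul_eq_cfc hH (-β)
    rw [Complex.ofReal_neg] at this
    rw [this, hQ, ← cfc_mul _ _ H (continuousOn_spectrum H _) (continuousOn_spectrum H _)]
    congr 1
    ext x
    rw [← Real.exp_add]
    ring_nf
  have hQu : IsUnit Q := by
    have hs : IsSelfAdjoint H := hH
    refine IsUnit.of_mul_eq_one (cfc (fun x : ℝ => Real.exp (β / 2 * x)) H) ?_
    rw [hQ, ← cfc_mul _ _ H (continuousOn_spectrum H _) (continuousOn_spectrum H _),
      ← cfc_one ℝ H]
    congr 1
    ext x
    rw [← Real.exp_add]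
    simp
  have hQ0 : (Q * Q).trace ≠ 0 := by
    have h := hQh.eq
    nth_rw 1 [← h]
    rw [Ne, Matrix.trace_conjTranspose_mul_self_eq_zero_iff]
    exact hQu.ne_zero
  have hpos : 0 ≤ (Q * Q).trace := by
    have h := (Matrix.posSemidef_conjTranspose_mul_self Q).trace_nonneg
    rwa [hQh.eq] at h
  obtain ⟨hre, him⟩ := Complex.nonneg_iff.1 hpos
  have hZ : (Q * Q).trace = ((Q * Q).trace.re : ℂ) := Complex.ext rfl (by simpa using him.symm)
  have hre' : (Q * Q).trace.re ≠ 0 := fun h => hQ0 (by rw [hZ, h, Complex.ofReal_zero])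
  set r := (Q * Q).trace.re with hr
  have hs : ((√r⁻¹ : ℝ) : ℂ) * ((√r⁻¹ : ℝ) : ℂ) = (r : ℂ)⁻¹ := by
    rw [← Complex.ofReal_mul, Real.mul_self_sqrt (inv_nonneg.2 hre), Complex.ofReal_inv]
  have hs0 : ((√r⁻¹ : ℝ) : ℂ) ≠ 0 := by
    intro h
    rw [h, mul_zero, eq_comm, inv_eq_zero, Complex.ofReal_eq_zero] at hs
    exact hre' hs
  refine ⟨((√r⁻¹ : ℝ) : ℂ) • Q, ?_, ?_, ?_⟩
  · rw [IsHermitian, conjTranspose_smul, hQh.eq, Complex.star_def, Complex.conj_ofReal]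
  · exact (IsUnit.smul (Units.mk0 _ hs0) hQu :)
  · rw [gibbsState, hK, smul_mul_smul_comm, hs, hZ]

theorem gnsInner_mul_self {R : Matrix n n ℂ} (hR : R.IsHermitian) (Y X : Matrix n n ℂ) :
    gnsInner (R * R) Y X = ((Y * R)ᴴ * (X * R)).trace := by
  rw [gnsInner, conjTranspose_mul, hR.eq, ← mul_assoc, Matrix.trace_mul_comm, ← mul_assoc,
    ← mul_assoc, ← mul_assoc]

open scoped ComplexOrder in
/-- The GNS inner product of `R * R`. -/
@[reducible] noncomputable def gnsCore {σ R : Matrix n n ℂ} (hR : R.IsHermitian) (hu : IsUnit R)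
    (hσ : σ = R * R) : InnerProductSpace.Core ℂ (Matrix n n ℂ) where
  inner Y X := gnsInner σ Y X
  conj_inner_symm Y X := by
    rw [hσ, gnsInner_mul_self hR, gnsInner_mul_self hR, starRingEnd_apply,
      ← Matrix.trace_conjTranspose, conjTranspose_mul, conjTranspose_conjTranspose]
  re_inner_nonneg X := by
    rw [hσ, gnsInner_mul_self hR]
    exact (Complex.nonneg_iff.1 (Matrix.posSemidef_conjTranspose_mul_self _).trace_nonneg).1
  add_left X Y Z := by
    simp [gnsInner, add_mul]
  smul_left X Y c := by
    simp [gnsInner]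
  definite X hX := by
    rw [hσ, gnsInner_mul_self hR, Matrix.trace_conjTranspose_mul_self_eq_zero_iff] at hX
    exact (hu.mul_left_eq_zero).1 hX

/-- The half of detailed balance that concerns the rates: their ratio cancels the factor from
`jumpOp_mul_gibbsState`. -/
theorem glauberRate_neg (β ω : ℝ) :
    glauberRate β (-ω) = Real.exp (β * ω) * glauberRate β ω := by
  have := Real.exp_pos (β * ω)
  rw [glauberRate, glauberRate, mul_neg, Real.exp_neg]
  field_simp
  ring

theorem glauberRate_pos (β ω : ℝ) : 0 < glauberRate β ω := by
  unfold glauberRate; positivity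

theorem sum_bohrFreq_neg {M : Type*} [AddCommMonoid M] (H : Matrix n n ℂ) (f : ℝ → M) :
    ∑ ω ∈ bohrFreq H, f (-ω) = ∑ ω ∈ bohrFreq H, f ω :=
  Finset.sum_nbij' (fun ω => -ω) (fun ω => -ω) (fun _ h => neg_mem_bohrFreq h)
    (fun _ h => neg_mem_bohrFreq h) (by simp) (by simp) (by simp)

theorem glauberRate_mul_trace {H S : Matrix n n ℂ} (hH : H.IsHermitian) (hS : S.IsHermitian)
    (β ω : ℝ) (M : Matrix n n ℂ) :
    (glauberRate β (-ω) : ℂ) * (M * (jumpOp H S (-ω)) * gibbsState H β).trace =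
      glauberRate β ω * ((jumpOp H S ω)ᴴ * M * gibbsState H β).trace := by
  rw [conjTranspose_jumpOp hS, mul_assoc, jumpOp_mul_gibbsState hH, glauberRate_neg,
    mul_smul_comm, Matrix.trace_smul, mul_neg, Real.exp_neg, ← mul_assoc M,
    Matrix.trace_mul_comm (M * _), mul_assoc]
  have := (Real.exp_pos (β * ω)).ne'
  have : (Real.exp (β * ω) : ℂ) ≠ 0 := by exact_mod_cast this
  push_cast at this ⊢
  rw [smul_eq_mul]
  field_simp

/-- The Dirichlet form of a Davies generator. -/
theorem gnsInner_davies {H S : Matrix n n ℂ} (hH : H.IsHermitian) (hS : S.IsHermitian)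
    (β : ℝ) (B A : Matrix n n ℂ) :
    gnsInner (gibbsState H β) B (davies H β S A) = -(1 / 2) * ∑ ω ∈ bohrFreq H,
      (glauberRate β ω : ℂ) * gnsInner (gibbsState H β)
        (jumpOp H S ω * B - B * jumpOp H S ω) (jumpOp H S ω * A - A * jumpOp H S ω) := by
  -- By detailed balance a jump adjoint at the far left can be traded for a jump next to the state,
  -- at equal total weight. As the frequencies are symmetric about zero, the two mixed terms of the
  -- expanded commutator form coincide (`h1`), and `V† B† A V` becomes `B† A V† V` (`h2`).
  set σ := gibbsState H β with hσ
  have h1 : ∑ ω ∈ bohrFreq H, (glauberRate β ω : ℂ) *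
      ((jumpOp H S ω)ᴴ * (Bᴴ * jumpOp H S ω * A) * σ).trace = ∑ ω ∈ bohrFreq H,
      (glauberRate β ω : ℂ) * (Bᴴ * (jumpOp H S ω)ᴴ * A * jumpOp H S ω * σ).trace := by
    rw [← sum_bohrFreq_neg H fun ω => (glauberRate β ω : ℂ) *
      (Bᴴ * (jumpOp H S ω)ᴴ * A * jumpOp H S ω * σ).trace]
    refine Finset.sum_congr rfl fun ω _ => ?_
    rw [glauberRate_mul_trace hH hS, conjTranspose_jumpOp hS (-ω), neg_neg]
  have h2 : ∑ ω ∈ bohrFreq H, (glauberRate β ω : ℂ) *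
      ((jumpOp H S ω)ᴴ * (Bᴴ * A * jumpOp H S ω) * σ).trace = ∑ ω ∈ bohrFreq H,
      (glauberRate β ω : ℂ) * (Bᴴ * A * (jumpOp H S ω)ᴴ * jumpOp H S ω * σ).trace := by
    rw [← sum_bohrFreq_neg H fun ω => (glauberRate β ω : ℂ) *
      (Bᴴ * A * (jumpOp H S ω)ᴴ * jumpOp H S ω * σ).trace]
    refine Finset.sum_congr rfl fun ω _ => ?_
    rw [glauberRate_mul_trace hH hS, conjTranspose_jumpOp hS (-ω), neg_neg]
  have e : ∀ ω, (glauberRate β ω : ℂ) * gnsInner σ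
        (jumpOp H S ω * B - B * jumpOp H S ω) (jumpOp H S ω * A - A * jumpOp H S ω) =
      (glauberRate β ω : ℂ) * (Bᴴ * (jumpOp H S ω)ᴴ * jumpOp H S ω * A * σ).trace
      - (glauberRate β ω : ℂ) * (Bᴴ * (jumpOp H S ω)ᴴ * A * jumpOp H S ω * σ).trace
      - (glauberRate β ω : ℂ) * ((jumpOp H S ω)ᴴ * (Bᴴ * jumpOp H S ω * A) * σ).trace
      + (glauberRate β ω : ℂ) * ((jumpOp H S ω)ᴴ * (Bᴴ * A * jumpOp H S ω) * σ).trace := by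
    intro ω
    simp only [gnsInner, conjTranspose_sub, conjTranspose_mul, sub_mul, mul_sub,
      Matrix.trace_sub, ← mul_assoc]
    ring
  simp_rw [e]
  rw [Finset.sum_add_distrib, Finset.sum_sub_distrib, Finset.sum_sub_distrib, h1, h2,
    ← Finset.sum_sub_distrib, ← Finset.sum_sub_distrib, ← Finset.sum_add_distrib, Finset.mul_sum,
    davies, LinearMap.sum_apply, gnsInner, Finset.mul_sum, Finset.sum_mul, Matrix.trace_sum]
  refine Finset.sum_congr rfl fun ω _ => ?_
  simp only [dissipator, LinearMap.smul_apply, LinearMap.sub_apply, LinearMap.comp_apply,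
    LinearMap.add_apply, LinearMap.mulLeft_apply, LinearMap.mulRight_apply, mul_smul_comm,
    smul_mul_assoc, Matrix.trace_smul, mul_sub, sub_mul, mul_add, add_mul, Matrix.trace_sub,
    Matrix.trace_add, smul_eq_mul, ← mul_assoc]
  ring

/-! ### Symmetries of Davies generators, and couplings that conserve energy. -/

theorem jumpOp_commute {H S b : Matrix n n ℂ} (hb : Commute H b) (hS : Commute S b)
    (ω : ℝ) : Commute (jumpOp H S ω) b := by
  refine Commute.sum_left _ _ _ fun p _ => ?_
  exact ((hb.cfc_real _).mul_left hS).mul_left (hb.cfc_real _)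

theorem jumpOp_mul_anticomm {H S b : Matrix n n ℂ} (hb : Commute H b) (hS : S * b = -(b * S))
    (ω : ℝ) : jumpOp H S ω * b = -(b * jumpOp H S ω) := by
  rw [jumpOp, Finset.sum_mul, Finset.mul_sum, ← Finset.sum_neg_distrib]
  refine Finset.sum_congr rfl fun p _ => ?_
  have h1 := (hb.cfc_real (fun x : ℝ => if x = p.1 then (1 : ℝ) else 0)).eq
  have h2 := (hb.cfc_real (fun x : ℝ => if x = p.2 then (1 : ℝ) else 0)).eq
  change eigenProj H p.1 * b = _ at h1
  change eigenProj H p.2 * b = _ at h2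
  change _ = b * eigenProj H p.1 at h1
  change _ = b * eigenProj H p.2 at h2
  rw [mul_assoc, h2, ← mul_assoc, mul_assoc _ S b, hS, mul_neg, ← mul_assoc, h1]
  simp [mul_assoc]

/-- A Davies generator commutes with left multiplication by an operator that commutes with the
Hamiltonian and with the coupling. -/
theorem davies_mul_left {H S b : Matrix n n ℂ} (hb : Commute H b) (hS : Commute S b)
    (hSh : S.IsHermitian) (β : ℝ) (T : Matrix n n ℂ) :
    davies H β S (b * T) = b * davies H β S T := by
  rw [davies, LinearMap.sum_apply, LinearMap.sum_apply, Finset.mul_sum]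
  refine Finset.sum_congr rfl fun ω _ => ?_
  have h1 := (jumpOp_commute hb hS ω).eq
  have h2 := (jumpOp_commute hb hS (-ω)).eq
  rw [← conjTranspose_jumpOp hSh] at h2
  set V := jumpOp H S ω
  have h3 : Vᴴ * V * b = b * (Vᴴ * V) := by rw [mul_assoc, h1, ← mul_assoc, h2, mul_assoc]
  simp only [dissipator, LinearMap.smul_apply, LinearMap.sub_apply, LinearMap.comp_apply,
    LinearMap.add_apply, LinearMap.mulLeft_apply, LinearMap.mulRight_apply]
  rw [← mul_assoc (Vᴴ * V), h3, mul_assoc b T V, ← mul_assoc Vᴴ b, h2]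
  simp only [mul_smul_comm, mul_sub, mul_add, mul_assoc]

/-- A Davies generator commutes with right multiplication by an operator that commutes with the
Hamiltonian and with the coupling. -/
theorem davies_mul_right {H S b : Matrix n n ℂ} (hb : Commute H b) (hS : Commute S b)
    (hSh : S.IsHermitian) (β : ℝ) (T : Matrix n n ℂ) :
    davies H β S (T * b) = davies H β S T * b := by
  rw [davies, LinearMap.sum_apply, LinearMap.sum_apply, Finset.sum_mul]
  refine Finset.sum_congr rfl fun ω _ => ?_
  have h1 := (jumpOp_commute hb hS ω).eq
  have h2 := (jumpOp_commute hb hS (-ω)).eq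
  rw [← conjTranspose_jumpOp hSh] at h2
  set V := jumpOp H S ω
  have h3 : Vᴴ * V * b = b * (Vᴴ * V) := by rw [mul_assoc, h1, ← mul_assoc, h2, mul_assoc]
  simp only [dissipator, LinearMap.smul_apply, LinearMap.sub_apply, LinearMap.comp_apply,
    LinearMap.add_apply, LinearMap.mulLeft_apply, LinearMap.mulRight_apply]
  rw [mul_assoc T b (Vᴴ * V), ← h3, mul_assoc T b V, ← h1]
  simp only [smul_mul_assoc, sub_mul, add_mul, mul_assoc]

/-- Covariance of a Davies generator under a symmetry `U` of the Hamiltonian that maps the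
coupling to its negative. -/
theorem davies_conj_anticomm {H S U : Matrix n n ℂ} (hU : Commute H U)
    (hS : S * U = -(U * S)) (hSh : S.IsHermitian) (β : ℝ) (T : Matrix n n ℂ) :
    davies H β S (U * T * U) = U * davies H β S T * U := by
  rw [davies, LinearMap.sum_apply, LinearMap.sum_apply, Finset.mul_sum, Finset.sum_mul]
  refine Finset.sum_congr rfl fun ω _ => ?_
  have h1 := jumpOp_mul_anticomm hU hS ω
  have h2 := jumpOp_mul_anticomm hU hS (-ω)
  rw [← conjTranspose_jumpOp hSh] at h2
  set V := jumpOp H S ω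
  have h3 : Vᴴ * V * U = U * (Vᴴ * V) := by
    rw [mul_assoc, h1, mul_neg, ← mul_assoc, h2, neg_mul, neg_neg, mul_assoc]
  simp only [dissipator, LinearMap.smul_apply, LinearMap.sub_apply, LinearMap.comp_apply,
    LinearMap.add_apply, LinearMap.mulLeft_apply, LinearMap.mulRight_apply]
  -- Moving `U` past `V` and past its adjoint costs one sign each, and the signs cancel.
  have e1 : Vᴴ * (U * T * U * V) = U * (Vᴴ * (T * V)) * U := by
    have h1' : U * V = -(V * U) := by rw [h1, neg_neg]
    rw [mul_assoc (U * T), h1', mul_neg, mul_neg, mul_assoc U T, ← mul_assoc Vᴴ U, h2]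
    simp only [neg_mul, neg_neg, mul_assoc]
  rw [e1, mul_assoc (U * T) U (Vᴴ * V), ← h3, mul_assoc U T U, ← mul_assoc (Vᴴ * V) U, h3]
  have h4 : Vᴴ * (V * U) = U * (Vᴴ * V) := by rw [← mul_assoc, h3]
  simp only [smul_mul_assoc, mul_smul_comm, mul_sub, mul_add, sub_mul, add_mul, mul_assoc, h4]

/-- The Davies generator of a coupling that commutes with the Hamiltonian. -/
theorem davies_of_commute {H S : Matrix n n ℂ} (hH : H.IsHermitian) (hS : Commute H S) (β : ℝ) :
    davies H β S = dissipator S := by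
  have h0 : ∀ ω, ω ≠ 0 → jumpOp H S ω = 0 := by
    intro ω hω
    refine Finset.sum_eq_zero fun p hp => ?_
    have h := (hS.cfc_real (fun x : ℝ => if x = p.1 then (1 : ℝ) else 0)).eq
    change eigenProj H p.1 * S = S * eigenProj H p.1 at h
    rw [h, mul_assoc, eigenProj_mul_eigenProj_of_ne, mul_zero]
    intro h
    rw [← (Finset.mem_filter.1 hp).2, h, sub_self] at hω
    exact hω rfl
  have hd : dissipator (0 : Matrix n n ℂ) = 0 := by ext1 T; simp [dissipator]
  have hsum := sum_jumpOp hH S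
  rw [davies]
  -- Only the zero frequency contributes, with Glauber rate `2 / (1 + 1) = 1`. If zero is not a Bohr
  -- frequency, the spectrum is empty and `S` vanishes, being a sum of zero jumps.
  by_cases hm : (0 : ℝ) ∈ bohrFreq H
  · rw [Finset.sum_eq_single_of_mem 0 hm fun ω _ h => h0 ω h] at hsum
    rw [Finset.sum_eq_single_of_mem 0 hm fun ω _ h => by rw [h0 ω h, hd, smul_zero], hsum]
    norm_num [glauberRate]
  · have hz : ∀ ω ∈ bohrFreq H, ω ≠ 0 := fun ω h e => hm (e ▸ h)
    rw [Finset.sum_eq_zero fun ω h => h0 ω (hz ω h)] at hsum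
    rw [Finset.sum_eq_zero fun ω h => by rw [h0 ω (hz ω h), hd, smul_zero], ← hsum, hd]

theorem davies_involution {H S : Matrix n n ℂ} (hH : H.IsHermitian) (hS : Commute H S)
    (hSh : S.IsHermitian) (hS2 : S * S = 1) (β : ℝ) (T : Matrix n n ℂ) :
    davies H β S T = S * T * S - T := by
  rw [davies_of_commute hH hS, dissipator, hSh.eq, hS2]
  simp only [LinearMap.smul_apply, LinearMap.sub_apply, LinearMap.comp_apply,
    LinearMap.add_apply, LinearMap.mulLeft_apply, LinearMap.mulRight_apply, one_mul, mul_one,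
    mul_assoc]
  rw [← two_smul ℂ T, smul_smul]
  norm_num

/-! ### Comparison of quadratic forms for the GNS product. -/

theorem gnsInner_add (σ Y X X' : Matrix n n ℂ) :
    gnsInner σ Y (X + X') = gnsInner σ Y X + gnsInner σ Y X' := by
  simp [gnsInner, mul_add, add_mul]

theorem gnsInner_add_left (σ Y Y' X : Matrix n n ℂ) :
    gnsInner σ (Y + Y') X = gnsInner σ Y X + gnsInner σ Y' X := by
  simp [gnsInner, add_mul]

theorem gnsInner_smul (σ Y X : Matrix n n ℂ) (c : ℂ) :
    gnsInner σ Y (c • X) = c * gnsInner σ Y X := by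
  simp [gnsInner]

/-- `T` is self-adjoint and positive semidefinite for the GNS inner product of `σ`. -/
def GNSNonneg (σ : Matrix n n ℂ) (T : Module.End ℂ (Matrix n n ℂ)) : Prop :=
  (∀ B A, gnsInner σ (T B) A = gnsInner σ B (T A)) ∧ ∀ A, 0 ≤ (gnsInner σ A (T A)).re

theorem GNSNonneg.add {σ : Matrix n n ℂ} {T T' : Module.End ℂ (Matrix n n ℂ)}
    (h : GNSNonneg σ T) (h' : GNSNonneg σ T') : GNSNonneg σ (T + T') := by
  refine ⟨fun B A => ?_, fun A => ?_⟩
  · rw [LinearMap.add_apply, LinearMap.add_apply, gnsInner_add, gnsInner_add_left, h.1, h'.1]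
  · rw [LinearMap.add_apply, gnsInner_add, Complex.add_re]
    exact add_nonneg (h.2 A) (h'.2 A)

theorem GNSNonneg.zero (σ : Matrix n n ℂ) : GNSNonneg σ 0 :=
  ⟨fun B A => by simp [gnsInner], fun A => by simp [gnsInner]⟩

theorem GNSNonneg.sum {σ : Matrix n n ℂ} {ι : Type*} {s : Finset ι}
    {T : ι → Module.End ℂ (Matrix n n ℂ)} (h : ∀ i ∈ s, GNSNonneg σ (T i)) :
    GNSNonneg σ (∑ i ∈ s, T i) :=
  Finset.sum_induction _ _ (fun _ _ => GNSNonneg.add) (GNSNonneg.zero σ) h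

theorem GNSNonneg.neg_sum {σ : Matrix n n ℂ} {ι : Type*} {s : Finset ι}
    {T : ι → Module.End ℂ (Matrix n n ℂ)} (h : ∀ i ∈ s, GNSNonneg σ (-T i)) :
    GNSNonneg σ (-∑ i ∈ s, T i) := by
  rw [← Finset.sum_neg_distrib]
  exact GNSNonneg.sum h

theorem GNSNonneg.neg_add {σ : Matrix n n ℂ} {T T' : Module.End ℂ (Matrix n n ℂ)}
    (h : GNSNonneg σ (-T)) (h' : GNSNonneg σ (-T')) : GNSNonneg σ (-(T + T')) := by
  rw [_root_.neg_add]
  exact GNSNonneg.add h h'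

/-- The quadratic form of the sum dominates that of a summand. -/
theorem GNSNonneg.single_le_sum {σ : Matrix n n ℂ} {ι : Type*} {s : Finset ι}
    {T : ι → Module.End ℂ (Matrix n n ℂ)} (h : ∀ i ∈ s, GNSNonneg σ (T i)) {i : ι} (hi : i ∈ s)
    (A : Matrix n n ℂ) :
    (gnsInner σ A (T i A)).re ≤ (gnsInner σ A ((∑ i ∈ s, T i) A)).re := by
  classical
  rw [← Finset.add_sum_erase _ _ hi, LinearMap.add_apply, gnsInner_add, Complex.add_re]
  have := (GNSNonneg.sum fun k hk => h k (Finset.mem_of_mem_erase hk) :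
    GNSNonneg σ (∑ k ∈ s.erase i, T k)).2 A
  linarith

theorem GNSNonneg.im_eq_zero [Nonempty n] {H : Matrix n n ℂ} (hH : H.IsHermitian) {β : ℝ}
    {T : Module.End ℂ (Matrix n n ℂ)} (h : GNSNonneg (gibbsState H β) T) (A : Matrix n n ℂ) :
    (gnsInner (gibbsState H β) A (T A)).im = 0 := by
  obtain ⟨R, hR, hu, hσ⟩ := exists_gibbsState_eq_mul_self hH β
  have h1 := (gnsCore hR hu hσ).conj_inner_symm A (T A)
  change starRingEnd ℂ (gnsInner _ (T A) A) = gnsInner _ A (T A) at h1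
  rw [h.1] at h1
  exact Complex.conj_eq_iff_im.1 h1

theorem gnsInner_self_pos [Nonempty n] {H : Matrix n n ℂ} (hH : H.IsHermitian) (β : ℝ)
    {A : Matrix n n ℂ} (hA : A ≠ 0) :
    0 < (gnsInner (gibbsState H β) A A).re ∧ (gnsInner (gibbsState H β) A A).im = 0 := by
  obtain ⟨R, hR, hu, hσ⟩ := exists_gibbsState_eq_mul_self hH β
  have h0 := (gnsCore hR hu hσ).re_inner_nonneg A
  have h1 := (gnsCore hR hu hσ).conj_inner_symm A A
  have h2 := fun h => hA ((gnsCore hR hu hσ).definite A h)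
  change 0 ≤ (gnsInner _ A A).re at h0
  change starRingEnd ℂ (gnsInner _ A A) = gnsInner _ A A at h1
  change gnsInner _ A A = 0 → False at h2
  have him := Complex.conj_eq_iff_im.1 h1
  exact ⟨lt_of_le_of_ne h0 fun h => h2 (Complex.ext h.symm him), him⟩

theorem re_gnsInner_self_nonneg [Nonempty n] {H : Matrix n n ℂ} (hH : H.IsHermitian) (β : ℝ)
    (A : Matrix n n ℂ) : 0 ≤ (gnsInner (gibbsState H β) A A).re := by
  by_cases hA : A = 0
  · simp [hA, gnsInner]
  · exact (gnsInner_self_pos hH β hA).1.le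

theorem re_gnsInner_neg_davies [Nonempty n] {H S : Matrix n n ℂ} (hH : H.IsHermitian)
    (hS : S.IsHermitian) (β : ℝ) (A : Matrix n n ℂ) :
    (gnsInner (gibbsState H β) A ((-davies H β S) A)).re = ∑ ω ∈ bohrFreq H,
      1 / 2 * glauberRate β ω * (gnsInner (gibbsState H β)
        (jumpOp H S ω * A - A * jumpOp H S ω) (jumpOp H S ω * A - A * jumpOp H S ω)).re := by
  rw [LinearMap.neg_apply, ← neg_one_smul ℂ (davies H β S A), gnsInner_smul,
    gnsInner_davies hH hS, ← mul_assoc, neg_one_mul, neg_neg, Finset.mul_sum, Complex.re_sum]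
  refine Finset.sum_congr rfl fun ω _ => ?_
  rw [← mul_assoc, show (1 / 2 : ℂ) * (glauberRate β ω : ℂ) = ((1 / 2 * glauberRate β ω : ℝ) : ℂ)
    by push_cast; ring, Complex.re_ofReal_mul]

theorem gnsNonneg_neg_davies [Nonempty n] {H S : Matrix n n ℂ} (hH : H.IsHermitian)
    (hS : S.IsHermitian) (β : ℝ) : GNSNonneg (gibbsState H β) (-davies H β S) := by
  refine ⟨fun B A => ?_, fun A => ?_⟩
  · obtain ⟨R, hR, hu, hσ⟩ := exists_gibbsState_eq_mul_self hH β
    have hc : ∀ X Y, starRingEnd ℂ (gnsInner (gibbsState H β) X Y) =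
      gnsInner (gibbsState H β) Y X := fun X Y => (gnsCore hR hu hσ).conj_inner_symm Y X
    rw [← hc, LinearMap.neg_apply, LinearMap.neg_apply, ← neg_one_smul ℂ (davies H β S A),
      ← neg_one_smul ℂ (davies H β S B), gnsInner_smul, gnsInner_smul, gnsInner_davies hH hS,
      gnsInner_davies hH hS, map_mul, map_mul, map_sum]
    simp only [map_mul, hc, map_neg, map_div₀, Complex.conj_ofReal, map_one, map_ofNat]
  · rw [re_gnsInner_neg_davies hH hS]
    exact Finset.sum_nonneg fun ω _ => mul_nonneg (by have := glauberRate_pos β ω; positivity)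
      (re_gnsInner_self_nonneg hH β _)

/-- An operator of zero Dirichlet form commutes with the coupling and with its commutator with the
Hamiltonian. -/
theorem commute_of_re_gnsInner_davies_eq_zero [Nonempty n] {H S : Matrix n n ℂ}
    (hH : H.IsHermitian) (hS : S.IsHermitian) {β : ℝ} {A : Matrix n n ℂ}
    (h : (gnsInner (gibbsState H β) A ((-davies H β S) A)).re = 0) :
    Commute S A ∧ Commute (H * S - S * H) A := by
  -- The form is a sum of squared GNS norms of commutators with strictly positive rates, so each
  -- commutator vanishes.
  have hV : ∀ ω ∈ bohrFreq H, Commute (jumpOp H S ω) A := by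
    intro ω hω
    rw [re_gnsInner_neg_davies hH hS, Finset.sum_eq_zero_iff_of_nonneg fun ω _ => mul_nonneg
      (by have := glauberRate_pos β ω; positivity) (re_gnsInner_self_nonneg hH β _)] at h
    have h1 := h ω hω
    by_contra hne
    have := (gnsInner_self_pos hH β (sub_ne_zero.2 hne)).1
    have := glauberRate_pos β ω
    exact absurd h1 (by positivity)
  constructor
  · rw [← sum_jumpOp hH S]
    exact Commute.sum_left _ _ _ hV
  · rw [← sum_freq_smul_jumpOp hH S]
    exact Commute.sum_left _ _ _ fun ω hω => (hV ω hω).smul_left _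

theorem davies_one (H S : Matrix n n ℂ) (β : ℝ) : davies H β S 1 = 0 := by
  rw [davies, LinearMap.sum_apply]
  refine Finset.sum_eq_zero fun ω _ => ?_
  simp only [dissipator, LinearMap.smul_apply, LinearMap.sub_apply, LinearMap.comp_apply,
    LinearMap.add_apply, LinearMap.mulLeft_apply, LinearMap.mulRight_apply, one_mul, mul_one]
  rw [← two_smul ℂ (_ * _), smul_smul]
  norm_num

end Davies

/-! ### The spectral gap as a variational quantity. -/

section SpectralGap

/-- Finiteness makes the infimum in `gapOn` attained as soon as a positive eigenvalue exists;
without one, `sInf` of the empty set would be the default value `0`. -/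
theorem finite_posEigenvalues {V : Type*} [AddCommGroup V] [Module ℂ V] [FiniteDimensional ℂ V]
    (T : Module.End ℂ V) (W : Submodule ℂ V) : (posEigenvalues T W).Finite := by
  refine ((Module.End.finite_hasEigenvalue T).preimage
    (f := fun r : ℝ => (r : ℂ)) Complex.ofReal_injective.injOn).subset ?_
  rintro r ⟨_, x, _, hx, hTx⟩
  exact Module.End.hasEigenvalue_of_hasEigenvector ⟨Module.End.mem_eigenspace_iff.2 hTx, hx⟩

theorem gapOn_mem {V : Type*} [AddCommGroup V] [Module ℂ V] [FiniteDimensional ℂ V]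
    {T : Module.End ℂ V} {W : Submodule ℂ V} (h : (posEigenvalues T W).Nonempty) :
    gapOn T W ∈ posEigenvalues T W :=
  h.csInf_mem (finite_posEigenvalues T W)

section Inner

variable {E : Type*} [NormedAddCommGroup E] [InnerProductSpace ℂ E] [FiniteDimensional ℂ E]

/-- Symmetry diagonalises `T` on the invariant subspace, and nonnegativity excludes negative
eigenvalues. Both facts about the gap below are read off in this basis. -/
theorem exists_eigenbasis {T : Module.End ℂ E} (hT : T.IsSymmetric)
    (hn : ∀ x, 0 ≤ (inner ℂ x (T x)).re) {W : Submodule ℂ E} (hW : ∀ x ∈ W, T x ∈ W) :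
    ∃ (b : OrthonormalBasis (Fin (Module.finrank ℂ W)) ℂ W) (l : Fin (Module.finrank ℂ W) → ℝ),
      (∀ i, T (b i) = (l i : ℂ) • (b i : E)) ∧ ∀ i, l i = 0 ∨ l i ∈ posEigenvalues T W := by
  have hS := hT.restrict_invariant hW
  have hb : ∀ i, T (hS.eigenvectorBasis rfl i) =
      (hS.eigenvalues rfl i : ℂ) • (hS.eigenvectorBasis rfl i : E) := fun i =>
    congrArg Subtype.val (hS.apply_eigenvectorBasis rfl i)
  have hne : ∀ i, (hS.eigenvectorBasis rfl i : E) ≠ 0 := fun i h =>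
    (hS.eigenvectorBasis rfl).orthonormal.ne_zero i (Subtype.ext h)
  refine ⟨hS.eigenvectorBasis rfl, hS.eigenvalues rfl, hb, fun i => ?_⟩
  by_cases h0 : hS.eigenvalues rfl i = 0
  · exact Or.inl h0
  refine Or.inr ⟨lt_of_le_of_ne ?_ (Ne.symm h0), _, (hS.eigenvectorBasis rfl i).2, hne i, hb i⟩
  have h1 := hn (hS.eigenvectorBasis rfl i : E)
  rw [hb, inner_smul_right, inner_self_eq_norm_sq_to_K] at h1
  have h2 : ‖(hS.eigenvectorBasis rfl i : E)‖ = 1 := (hS.eigenvectorBasis rfl).orthonormal.1 i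
  rw [h2] at h1
  simpa using h1

theorem posEigenvalues_nonempty_aux {T : Module.End ℂ E} (hT : T.IsSymmetric)
    (hn : ∀ x, 0 ≤ (inner ℂ x (T x)).re) {W : Submodule ℂ E} (hW : ∀ x ∈ W, T x ∈ W)
    {y : E} (hy : y ∈ W) (hTy : T y ≠ 0) : (posEigenvalues T W).Nonempty := by
  obtain ⟨b, l, hb, hl⟩ := exists_eigenbasis hT hn hW
  by_contra hemp
  have h0 : ∀ i, l i = 0 := fun i => (hl i).resolve_right fun h => hemp ⟨_, h⟩
  apply hTy
  have h1 := congrArg (fun z : W => T z) (b.sum_repr ⟨y, hy⟩)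
  simp only [Submodule.coe_sum, Submodule.coe_smul, map_sum, map_smul, hb, h0] at h1
  rw [← h1]
  simp

/-- The Poincaré inequality: components along the kernel vanish by orthogonality, and every other
component carries an eigenvalue no smaller than the gap. -/
theorem gapOn_mul_le_aux {T : Module.End ℂ E} (hT : T.IsSymmetric)
    (hn : ∀ x, 0 ≤ (inner ℂ x (T x)).re) {W : Submodule ℂ E} (hW : ∀ x ∈ W, T x ∈ W)
    {y : E} (hy : y ∈ W) (horth : ∀ z ∈ W, T z = 0 → inner ℂ z y = 0) :
    gapOn T W * (inner ℂ y y).re ≤ (inner ℂ y (T y)).re := by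
  obtain ⟨b, l, hb, hl⟩ := exists_eigenbasis hT hn hW
  have hsum : ∀ z : E, z ∈ W → inner ℂ y z =
      ∑ i, inner ℂ y (b i : E) * inner ℂ (b i : E) z := by
    intro z hz
    exact (b.sum_inner_mul_inner ⟨y, hy⟩ ⟨z, hz⟩).symm
  have hre : ∀ i, (inner ℂ y (b i : E) * inner ℂ (b i : E) y) =
      ((‖inner ℂ (b i : E) y‖ ^ 2 : ℝ) : ℂ) := by
    intro i
    rw [← inner_conj_symm, Complex.conj_mul']
    push_cast
    rfl
  rw [hsum y hy, hsum (T y) (hW y hy), Complex.re_sum, Complex.re_sum, Finset.mul_sum]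
  refine Finset.sum_le_sum fun i _ => ?_
  rw [← hT, hb, inner_smul_left, Complex.conj_ofReal, mul_left_comm, hre, ← Complex.ofReal_mul,
    Complex.ofReal_re, Complex.ofReal_re]
  rcases hl i with h | h
  · rw [horth _ (b i).2 (by rw [hb, h]; simp)]
    simp
  · exact mul_le_mul_of_nonneg_right (csInf_le (finite_posEigenvalues T W).bddBelow h)
      (by positivity)

end Inner

variable {V : Type*} [AddCommGroup V] [Module ℂ V] [FiniteDimensional ℂ V]

/-- The inner product depends on the state, so it is passed as a `Core` and the normed structure is
installed only inside the proof. -/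
theorem posEigenvalues_nonempty (c : InnerProductSpace.Core ℂ V) {T : Module.End ℂ V}
    (hT : ∀ x y, c.inner (T x) y = c.inner x (T y)) (hn : ∀ x, 0 ≤ (c.inner x (T x)).re)
    {W : Submodule ℂ V} (hW : ∀ x ∈ W, T x ∈ W) {y : V} (hy : y ∈ W) (hTy : T y ≠ 0) :
    (posEigenvalues T W).Nonempty := by
  let := c.toNormedAddCommGroup
  let : InnerProductSpace ℂ V := InnerProductSpace.ofCore c.toCore
  exact posEigenvalues_nonempty_aux (E := V) hT hn hW hy hTy

theorem gapOn_mul_le (c : InnerProductSpace.Core ℂ V) {T : Module.End ℂ V}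
    (hT : ∀ x y, c.inner (T x) y = c.inner x (T y)) (hn : ∀ x, 0 ≤ (c.inner x (T x)).re)
    {W : Submodule ℂ V} (hW : ∀ x ∈ W, T x ∈ W) {y : V} (hy : y ∈ W)
    (horth : ∀ z ∈ W, T z = 0 → c.inner z y = 0) :
    gapOn T W * (c.inner y y).re ≤ (c.inner y (T y)).re := by
  let := c.toNormedAddCommGroup
  let : InnerProductSpace ℂ V := InnerProductSpace.ofCore c.toCore
  exact gapOn_mul_le_aux (E := V) hT hn hW hy horth

end SpectralGap

section GNSGap

variable {n : Type*} [Fintype n] [DecidableEq n] [Nonempty n]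

theorem GNSNonneg.posEigenvalues_nonempty {H : Matrix n n ℂ} (hH : H.IsHermitian) {β : ℝ}
    {T : Module.End ℂ (Matrix n n ℂ)} (hT : GNSNonneg (gibbsState H β) T)
    {W : Submodule ℂ (Matrix n n ℂ)} (hW : ∀ x ∈ W, T x ∈ W) {y : Matrix n n ℂ} (hy : y ∈ W)
    (hTy : T y ≠ 0) : (posEigenvalues T W).Nonempty := by
  obtain ⟨R, hR, hu, hσ⟩ := exists_gibbsState_eq_mul_self hH β
  exact _root_.posEigenvalues_nonempty (gnsCore hR hu hσ) hT.1 hT.2 hW hy hTy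

theorem GNSNonneg.gapOn_mul_le {H : Matrix n n ℂ} (hH : H.IsHermitian) {β : ℝ}
    {T : Module.End ℂ (Matrix n n ℂ)} (hT : GNSNonneg (gibbsState H β) T)
    {W : Submodule ℂ (Matrix n n ℂ)} (hW : ∀ x ∈ W, T x ∈ W) {y : Matrix n n ℂ} (hy : y ∈ W)
    (horth : ∀ z ∈ W, T z = 0 → gnsInner (gibbsState H β) z y = 0) :
    gapOn T W * (gnsInner (gibbsState H β) y y).re ≤ (gnsInner (gibbsState H β) y (T y)).re := by
  obtain ⟨R, hR, hu, hσ⟩ := exists_gibbsState_eq_mul_self hH β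
  exact _root_.gapOn_mul_le (gnsCore hR hu hσ) hT.1 hT.2 hW hy horth

end GNSGap

/-! ### Pauli operators indexed by vectors over `ZMod 2`. -/

namespace Toric

variable {L : ℕ} [NeZero L]

/-- The tensor product of one-site operators. -/
def siteProd (f : Edge L → Matrix (Fin 2) (Fin 2) ℂ) : Op L := fun s t => ∏ k, f k (s k) (t k)

/-- Distributivity: a sum over configurations of a product over edges is the product over edges of
sums. Pauli identities thereby reduce to a single site. -/
theorem siteProd_mul (f g : Edge L → Matrix (Fin 2) (Fin 2) ℂ) :
    siteProd f * siteProd g = siteProd fun k => f k * g k := by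
  ext s t
  simp only [siteProd, Matrix.mul_apply, ← Finset.prod_mul_distrib]
  rw [Finset.prod_univ_sum, Fintype.piFinset_univ]

theorem siteProd_smul (c : Edge L → ℂ) (f : Edge L → Matrix (Fin 2) (Fin 2) ℂ) :
    siteProd (fun k => c k • f k) = (∏ k, c k) • siteProd f := by
  ext s t
  simp [siteProd, Finset.prod_mul_distrib]

theorem siteProd_single (s t : Cfg L) :
    siteProd (fun k => Matrix.single (s k) (t k) (1 : ℂ)) = Matrix.single s t 1 := by
  ext s' t'
  simp only [siteProd, Matrix.single_apply, Finset.prod_ite_zero, Finset.prod_const_one,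
    Finset.mem_univ, true_imp_iff, funext_iff, forall_and]

theorem siteProd_one : siteProd (fun _ => 1 : Edge L → Matrix (Fin 2) (Fin 2) ℂ) = 1 := by
  ext s t
  simp only [siteProd, Matrix.one_apply, Finset.prod_ite_zero, Finset.prod_const_one,
    Finset.mem_univ, true_imp_iff, funext_iff]

theorem conjTranspose_siteProd (f : Edge L → Matrix (Fin 2) (Fin 2) ℂ) :
    (siteProd f)ᴴ = siteProd fun k => (f k)ᴴ := by
  ext s t
  simp [siteProd, Matrix.conjTranspose_apply]

theorem siteProd_sum {ι : Type*} [Fintype ι] [DecidableEq ι]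
    (f : Edge L → ι → Matrix (Fin 2) (Fin 2) ℂ) :
    siteProd (fun k => ∑ a, f k a) = ∑ w : Edge L → ι, siteProd fun k => f k (w k) := by
  ext s t
  simp only [siteProd, Matrix.sum_apply]
  rw [Finset.prod_univ_sum, Fintype.piFinset_univ]

/-- The operator `∏ M_j` over the sites with `u j = 1`. -/
def pauli (M : Matrix (Fin 2) (Fin 2) ℂ) (u : Edge L → ZMod 2) : Op L :=
  siteProd fun k => if u k = 0 then 1 else M

/-- The indicator vector of a set of edges. -/
def ind (A : Finset (Edge L)) : Edge L → ZMod 2 := fun k => if k ∈ A then 1 else 0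

theorem onSites_eq_pauli (A : Finset (Edge L)) (M : Matrix (Fin 2) (Fin 2) ℂ) :
    onSites A M = pauli M (ind A) := by
  ext s t
  refine Finset.prod_congr rfl fun k _ => ?_
  by_cases h : k ∈ A <;> simp [ind, h]

theorem ind_singleton (j : Edge L) : ind {j} = Pi.single j 1 := by
  ext k
  by_cases h : k = j
  · subst h; simp [ind]
  · simp [ind, h]

theorem ind_dotProduct_ind (A B : Finset (Edge L)) :
    ind A ⬝ᵥ ind B = ((A ∩ B).card : ZMod 2) := by
  simp only [ind, dotProduct, ite_mul, one_mul, zero_mul, ← ite_and, ← Finset.mem_inter]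
  rw [Finset.sum_boole, Finset.filter_mem_eq_inter, Finset.univ_inter]

theorem zmod_two_cases (a : ZMod 2) : a = 0 ∨ a = 1 := by
  revert a; decide

theorem pauli_zero (M : Matrix (Fin 2) (Fin 2) ℂ) : pauli M (0 : Edge L → ZMod 2) = 1 := by
  simp [pauli, siteProd_one]

theorem pauli_add {M : Matrix (Fin 2) (Fin 2) ℂ} (hM : M * M = 1) (u v : Edge L → ZMod 2) :
    pauli M (u + v) = pauli M u * pauli M v := by
  rw [pauli, pauli, pauli, siteProd_mul]
  congr 1
  ext1 k
  rcases zmod_two_cases (u k) with h | h <;> rcases zmod_two_cases (v k) with h' | h' <;>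
    simp [h, h', hM, CharTwo.add_self_eq_zero]

theorem pauliX_mul_self : pauliX * pauliX = 1 := by
  ext i j; fin_cases i <;> fin_cases j <;> simp [pauliX]

theorem pauliZ_mul_self : pauliZ * pauliZ = 1 := by
  ext i j; fin_cases i <;> fin_cases j <;> simp [pauliZ]

theorem isHermitian_pauliX : pauliX.IsHermitian := by
  ext i j; fin_cases i <;> fin_cases j <;> simp [pauliX]

theorem isHermitian_pauliY : pauliY.IsHermitian := by
  ext i j; fin_cases i <;> fin_cases j <;> simp [pauliY]

theorem isHermitian_pauliZ : pauliZ.IsHermitian := by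
  ext i j; fin_cases i <;> fin_cases j <;> simp [pauliZ]

theorem pauli_mul_self {M : Matrix (Fin 2) (Fin 2) ℂ} (hM : M * M = 1) (u : Edge L → ZMod 2) :
    pauli M u * pauli M u = 1 := by
  rw [← pauli_add hM, CharTwo.add_self_eq_zero, pauli_zero]

theorem isHermitian_pauli {M : Matrix (Fin 2) (Fin 2) ℂ} (hM : M.IsHermitian)
    (u : Edge L → ZMod 2) : (pauli M u).IsHermitian := by
  rw [IsHermitian, pauli, conjTranspose_siteProd]
  congr 1
  ext1 k
  split_ifs <;> simp [hM.eq]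

theorem pauli_commute {M : Matrix (Fin 2) (Fin 2) ℂ} (hM : M * M = 1) (u v : Edge L → ZMod 2) :
    Commute (pauli M u) (pauli M v) := by
  rw [Commute, SemiconjBy, ← pauli_add hM, ← pauli_add hM, add_comm]

/-- The sign `(-1)^a`. -/
def sgn (a : ZMod 2) : ℂ := if a = 0 then 1 else -1

@[simp] theorem sgn_zero : sgn 0 = 1 := rfl

@[simp] theorem sgn_one : sgn 1 = -1 := by simp [sgn]

theorem sgn_add (a b : ZMod 2) : sgn (a + b) = sgn a * sgn b := by
  rcases zmod_two_cases a with rfl | rfl <;> rcases zmod_two_cases b with rfl | rfl <;>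
    simp [CharTwo.add_self_eq_zero]

theorem sgn_sum {ι : Type*} (s : Finset ι) (f : ι → ZMod 2) :
    sgn (∑ i ∈ s, f i) = ∏ i ∈ s, sgn (f i) := by
  classical
  induction s using Finset.induction_on with
  | empty => simp
  | insert a s ha ih => rw [Finset.sum_insert ha, Finset.prod_insert ha, sgn_add, ih]

theorem sgn_mul_self (a : ZMod 2) : sgn a * sgn a = 1 := by
  rcases zmod_two_cases a with rfl | rfl <;> simp

theorem pauliZ_mul_pauliX : pauliZ * pauliX = -(pauliX * pauliZ) := by
  ext i j; fin_cases i <;> fin_cases j <;> simp [pauliX, pauliZ]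

/-- Each site in both supports contributes one sign. Commutation of these products thus becomes a
pairing over `ZMod 2`. -/
theorem pauliZ_pauliX (v u : Edge L → ZMod 2) :
    pauli pauliZ v * pauli pauliX u = sgn (v ⬝ᵥ u) • (pauli pauliX u * pauli pauliZ v) := by
  rw [pauli, pauli, siteProd_mul, siteProd_mul, dotProduct, sgn_sum, ← siteProd_smul]
  congr 1
  ext1 k
  rcases zmod_two_cases (u k) with h | h <;> rcases zmod_two_cases (v k) with h' | h' <;>
    simp [h, h', pauliZ_mul_pauliX]

theorem pauliX_pauliZ (u v : Edge L → ZMod 2) :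
    pauli pauliX u * pauli pauliZ v = sgn (v ⬝ᵥ u) • (pauli pauliZ v * pauli pauliX u) := by
  rw [pauliZ_pauliX, smul_smul, sgn_mul_self, one_smul]

theorem commute_pauliX_pauliZ {u v : Edge L → ZMod 2} (h : v ⬝ᵥ u = 0) :
    Commute (pauli pauliX u) (pauli pauliZ v) := by
  rw [Commute, SemiconjBy, pauliX_pauliZ, h, sgn_zero, one_smul]

theorem pauliY_eq : pauliY = Complex.I • (pauliX * pauliZ) := by
  ext i j; fin_cases i <;> fin_cases j <;> simp [pauliX, pauliZ, pauliY]

theorem onSites_pauliY (j : Edge L) :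
    onSites {j} pauliY = Complex.I • (onSites {j} pauliX * onSites {j} pauliZ) := by
  have : Complex.I = ∏ k : Edge L, if k = j then Complex.I else 1 := by simp
  simp only [onSites_eq_pauli, pauli, siteProd_mul]
  rw [this, ← siteProd_smul]
  congr 1
  ext1 k
  by_cases h : k = j <;> simp [ind, h, pauliY_eq]

theorem sum_pauli_eq (M : Matrix (Fin 2) (Fin 2) ℂ) :
    ∃ c : ZMod 2 × ZMod 2 → ℂ, M = ∑ a, c a •
      ((if a.1 = 0 then 1 else pauliX) * (if a.2 = 0 then 1 else pauliZ)) := by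
  refine ⟨fun a => if a.1 = 0 then (if a.2 = 0 then (M 0 0 + M 1 1) / 2 else (M 0 0 - M 1 1) / 2)
    else (if a.2 = 0 then (M 0 1 + M 1 0) / 2 else (M 1 0 - M 0 1) / 2), ?_⟩
  have h2 : ∀ f : ZMod 2 → Matrix (Fin 2) (Fin 2) ℂ, ∑ a, f a = f 0 + f 1 :=
    fun f => Fin.sum_univ_two f
  rw [Fintype.sum_prod_type, h2, h2, h2]
  ext i j
  fin_cases i <;> fin_cases j <;> simp [pauliX, pauliZ] <;> ring

/-- The Pauli operators span the operators. -/
theorem span_pauli :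
    Submodule.span ℂ (Set.range fun w : (Edge L → ZMod 2) × (Edge L → ZMod 2) =>
      pauli pauliX w.1 * pauli pauliZ w.2) = ⊤ := by
  rw [eq_top_iff]
  intro A _
  rw [Matrix.matrix_eq_sum_single A]
  refine Submodule.sum_mem _ fun s _ => Submodule.sum_mem _ fun t _ => ?_
  rw [← mul_one (A s t), ← smul_eq_mul, ← Matrix.smul_single]
  refine Submodule.smul_mem _ _ ?_
  -- A matrix unit is a tensor product of one-site matrix units; expanding each factor in `1, X, Z,
  -- XZ` gives a combination of Pauli operators.
  rw [← siteProd_single]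
  choose c hc using sum_pauli_eq
  rw [show (fun k => Matrix.single (s k) (t k) (1 : ℂ)) = _ from
    funext fun k => hc (Matrix.single (s k) (t k) (1 : ℂ)), siteProd_sum]
  refine Submodule.sum_mem _ fun w _ => ?_
  rw [siteProd_smul, ← siteProd_mul]
  exact Submodule.smul_mem _ _ (Submodule.subset_span ⟨(fun k => (w k).1, fun k => (w k).2), rfl⟩)

/-- An operator that commutes with all Pauli operators is a scalar. -/
theorem eq_smul_one_of_commute {A : Op L} (hX : ∀ u : Edge L → ZMod 2, Commute (pauli pauliX u) A)
    (hZ : ∀ v : Edge L → ZMod 2, Commute (pauli pauliZ v) A) : ∃ c : ℂ, A = c • 1 := by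
  have h : ∀ T : Op L, Commute T A := by
    intro T
    have hT : T ∈ Submodule.span ℂ (Set.range fun w : (Edge L → ZMod 2) × (Edge L → ZMod 2) =>
      pauli pauliX w.1 * pauli pauliZ w.2) := by
      rw [span_pauli]; exact Submodule.mem_top
    induction hT using Submodule.span_induction with
    | mem x hx =>
      obtain ⟨w, rfl⟩ := hx
      exact (hX _).mul_left (hZ _)
    | zero => exact Commute.zero_left _
    | add x y _ _ hx hy => exact hx.add_left hy
    | smul c x _ hx => exact hx.smul_left c
  obtain ⟨c, hc⟩ := Matrix.mem_range_scalar_of_commute_single fun i j _ =>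
    h (Matrix.single i j 1)
  exact ⟨c, by rw [← hc, Matrix.smul_one_eq_diagonal]; rfl⟩

/-! ### Lattice geometry and linear algebra over `ZMod 2`, for cells and nodes alike. -/

/-- Every edge belongs to exactly two of the sets `nbhd r`. -/
def TwoEnds (nbhd : Node L → Finset (Edge L)) : Prop :=
  ∀ j, ∃ a b, a ≠ b ∧ ∀ r, j ∈ nbhd r ↔ r = a ∨ r = b

theorem twoEnds_plaq (hL : 2 ≤ L) : TwoEnds (plaq (L := L)) := by
  have : Fact (1 < L) := ⟨hL⟩
  rintro (v | v)
  · refine ⟨v, v - (0, 1), by simp [eq_sub_iff_add_eq, Prod.ext_iff], fun r => ?_⟩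
    simp [plaq, eq_comm, eq_sub_iff_add_eq]
  · refine ⟨v, v - (1, 0), by simp [eq_sub_iff_add_eq, Prod.ext_iff], fun r => ?_⟩
    simp [plaq, eq_comm, eq_sub_iff_add_eq]

theorem twoEnds_star (hL : 2 ≤ L) : TwoEnds (star (L := L)) := by
  have : Fact (1 < L) := ⟨hL⟩
  rintro (v | v)
  · refine ⟨v, v + (1, 0), by simp [Prod.ext_iff], fun r => ?_⟩
    simp [star, eq_comm, eq_sub_iff_add_eq]
  · refine ⟨v, v + (0, 1), by simp [Prod.ext_iff], fun r => ?_⟩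
    simp [star, eq_comm, eq_sub_iff_add_eq]

/-- Each corner of a cell is an endpoint of exactly two of its edges, so in the incidence sum every
condition "`s` is this corner" occurs twice and cancels. The bound on `L` keeps the four edges of a
star, and of a cell, distinct. -/
theorem ind_plaq_dotProduct_ind_star (hL : 2 ≤ L) (p s : Node L) :
    ind (plaq p) ⬝ᵥ ind (star s) = 0 := by
  have : Fact (1 < L) := ⟨hL⟩
  have h : ind (plaq p) = Pi.single (Sum.inl p) 1 + Pi.single (Sum.inl (p + (0, 1))) 1
      + Pi.single (Sum.inr p) 1 + Pi.single (Sum.inr (p + (1, 0))) 1 := by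
    ext k
    rcases k with k | k
    · have : p ≠ p + (0, 1) := by simp [Prod.ext_iff]
      by_cases h1 : k = p <;> by_cases h2 : k = p + (0, 1) <;>
        simp_all [ind, plaq]
    · have : p ≠ p + (1, 0) := by simp [Prod.ext_iff]
      by_cases h1 : k = p <;> by_cases h2 : k = p + (1, 0) <;>
        simp_all [ind, plaq]
  have h' : ∀ a b : Node L, a ≠ b → ∀ x : Node L,
      (if x = a ∨ x = b then (1 : ZMod 2) else 0) = (if x = a then 1 else 0)
        + if x = b then 1 else 0 := by
    intro a b hab x
    by_cases h1 : x = a <;> by_cases h2 : x = b <;> simp_all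
  have e1 : s ≠ s - (1, 0) := by simp [eq_sub_iff_add_eq, Prod.ext_iff]
  have e2 : s ≠ s - (0, 1) := by simp [eq_sub_iff_add_eq, Prod.ext_iff]
  rw [h]
  simp only [add_dotProduct, single_one_dotProduct, ind, star, Finset.mem_insert,
    Finset.mem_singleton, Sum.inl.injEq, Sum.inr.injEq, reduceCtorEq, or_false, false_or,
    h' _ _ e1, h' _ _ e2]
  have e3 : p + (0, 1) = s - (1, 0) ↔ p + (1, 0) = s - (0, 1) := by
    rw [eq_sub_iff_add_eq, eq_sub_iff_add_eq, add_assoc, add_assoc, add_comm (0, 1)]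
  have e4 : p = s - (1, 0) ↔ p + (1, 0) = s := eq_sub_iff_add_eq
  have e5 : p = s - (0, 1) ↔ p + (0, 1) = s := eq_sub_iff_add_eq
  simp only [e3, e4, e5]
  generalize (if p = s then (1 : ZMod 2) else 0) = a
  generalize (if p + (1, 0) = s then (1 : ZMod 2) else 0) = b
  generalize (if p + (0, 1) = s then (1 : ZMod 2) else 0) = c
  generalize (if p + (1, 0) = s - (0, 1) then (1 : ZMod 2) else 0) = d
  revert a b c d
  decide

theorem linkGraph_induction {nbhd : Node L → Finset (Edge L)} {K : Finset (Edge L)}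
    (hc : (linkGraph nbhd K).Connected) {P : Node L → Prop} {p : Node L} (hp : P p)
    (step : ∀ q r, q ≠ r → ∀ j ∈ K, j ∈ nbhd q → j ∈ nbhd r → P q → P r) (q : Node L) : P q := by
  have h := (SimpleGraph.reachable_iff_reflTransGen p q).1 (hc.preconnected p q)
  induction h with
  | refl => exact hp
  | tail _ hadj ih =>
    rw [linkGraph, SimpleGraph.fromRel_adj] at hadj
    obtain ⟨hne, ⟨j, hj, h1, h2⟩ | ⟨j, hj, h1, h2⟩⟩ := hadj
    · exact step _ _ hne j hj h1 h2 ih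
    · exact step _ _ hne j hj h2 h1 ih

/-- The set of ends of an edge, as a vector. -/
def ends (nbhd : Node L → Finset (Edge L)) (j : Edge L) : Node L → ZMod 2 :=
  fun r => if j ∈ nbhd r then 1 else 0

theorem TwoEnds.iff {nbhd : Node L → Finset (Edge L)} (h : TwoEnds nbhd) {j : Edge L}
    {p q : Node L} (hpq : p ≠ q) (hp : j ∈ nbhd p) (hq : j ∈ nbhd q) (r : Node L) :
    j ∈ nbhd r ↔ r = p ∨ r = q := by
  obtain ⟨a, b, hab, hr⟩ := h j
  rw [hr] at hp hq ⊢
  grind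

theorem TwoEnds.ends_eq {nbhd : Node L → Finset (Edge L)} (h : TwoEnds nbhd) {j : Edge L}
    {p q : Node L} (hpq : p ≠ q) (hp : j ∈ nbhd p) (hq : j ∈ nbhd q) :
    ends nbhd j = Pi.single p 1 + Pi.single q 1 := by
  ext r
  have := h.iff hpq hp hq r
  by_cases h1 : r = p <;> by_cases h2 : r = q <;> simp_all [ends]

/-- An edge joining `q` and `r` gives the sum of their unit vectors, so a walk along `K` starting at
`p` reaches every unit vector. -/
theorem span_ends {nbhd : Node L → Finset (Edge L)} (h2 : TwoEnds nbhd) {K : Finset (Edge L)}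
    (hc : (linkGraph nbhd K).Connected) (p : Node L) :
    Submodule.span (ZMod 2) (insert (Pi.single p 1) (ends nbhd '' (K : Set (Edge L)))) = ⊤ := by
  set M := Submodule.span (ZMod 2) (insert (Pi.single p 1) (ends nbhd '' (K : Set (Edge L))))
  have hs : ∀ q, (Pi.single q 1 : Node L → ZMod 2) ∈ M := by
    refine linkGraph_induction hc (p := p) (Submodule.subset_span (Set.mem_insert _ _)) ?_
    intro q r hqr j hj hq hr hM
    have h : ends nbhd j ∈ M :=
      Submodule.subset_span (Set.mem_insert_of_mem _ (Set.mem_image_of_mem _ hj))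
    rw [h2.ends_eq hqr hq hr] at h
    simpa using M.sub_mem h hM
  rw [eq_top_iff]
  intro x _
  rw [pi_eq_sum_univ x]
  refine M.sum_mem fun q _ => M.smul_mem _ ?_
  convert hs q using 1
  ext r
  simp [Pi.single_apply, eq_comm]

/-- The spanning-tree bound, read off from the size of the spanning family in `span_ends`. -/
theorem card_node_le {nbhd : Node L → Finset (Edge L)} (h2 : TwoEnds nbhd) {K : Finset (Edge L)}
    (hc : (linkGraph nbhd K).Connected) : Fintype.card (Node L) ≤ K.card + 1 := by
  classical
  have h := finrank_span_finset_le_card (R := ZMod 2)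
    (insert (Pi.single (0 : Node L) 1) (K.image (ends nbhd)))
  rw [Finset.coe_insert, Finset.coe_image, Set.finrank, span_ends h2 hc, finrank_top,
    Module.finrank_fintype_fun_eq_card] at h
  exact h.trans ((Finset.card_insert_le _ _).trans (Nat.succ_le_succ Finset.card_image_le))

/-- The pairings of a vector with the edges in `K`, with the sets `nbhd p` and with two loops. -/
def pairing (nbhd : Node L → Finset (Edge L)) (K : Finset (Edge L))
    (w : Fin 2 → Edge L → ZMod 2) :
    (Edge L → ZMod 2) →ₗ[ZMod 2] ((K → ZMod 2) × (Node L → ZMod 2) × (Fin 2 → ZMod 2)) where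
  toFun x := (fun k => x k, fun p => ind (nbhd p) ⬝ᵥ x, fun i => w i ⬝ᵥ x)
  map_add' x y := by simp only [dotProduct_add]; rfl
  map_smul' c x := by simp only [dotProduct_smul]; rfl

/-- A rank count. Up to one extra vector the range fills the target, of dimension `|K'| + L² + 2`:
the loops `u` reach the third factor, the edges of `K` then the second, the edges of `K'` then the
first. Since `K'` is connected, `|K'| + 1 ≥ L²`, so the rank is at least `2 L²`, the dimension of
the source. -/
theorem pairing_injective {nbhd nbhd' : Node L → Finset (Edge L)} {K K' : Finset (Edge L)}
    (h2 : TwoEnds nbhd) (h2' : TwoEnds nbhd') (hc : (linkGraph nbhd K).Connected)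
    (hc' : (linkGraph nbhd' K').Connected) (hd : Disjoint K K') {u w : Fin 2 → Edge L → ZMod 2}
    (hu : ∀ i, ∀ k ∈ K', u i k = 0) (hun : ∀ i p, ind (nbhd p) ⬝ᵥ u i = 0)
    (huw : ∀ i k, w k ⬝ᵥ u i = if i = k then 1 else 0) :
    Function.Injective (pairing nbhd K' w) := by
  classical
  set F := pairing nbhd K' w
  -- The extra vector is needed: every edge has two ends, so the node pairings of any vector add up
  -- to zero.
  set Q := LinearMap.range F ⊔ Submodule.span (ZMod 2) {(0, Pi.single 0 1, 0)} with hQ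
  have hF : ∀ x, F x ∈ Q := fun x => Submodule.mem_sup_left ⟨x, rfl⟩
  have h3 : ∀ f : Fin 2 → ZMod 2, (0, 0, f) ∈ Q := by
    intro f
    have : ((0, 0, f) : (K' → ZMod 2) × (Node L → ZMod 2) × (Fin 2 → ZMod 2)) =
        ∑ i, f i • F (u i) := by
      refine Prod.ext ?_ (Prod.ext ?_ ?_)
      · ext k
        simp [F, pairing, hu _ _ k.2]
      · ext p
        simp [F, pairing, hun]
      · ext i
        fin_cases i <;> simp [F, pairing, huw]
    rw [this]
    exact Q.sum_mem fun i _ => Q.smul_mem _ (hF _)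
  have hsingle : ∀ j, F (Pi.single j 1) =
      (fun k : K' => (Pi.single j 1 : Edge L → ZMod 2) k, ends nbhd j, fun i => w i j) := by
    intro j
    simp only [F, pairing, LinearMap.coe_mk, AddHom.coe_mk, dotProduct_single_one]
    rfl
  have h4 : ∀ x : Node L → ZMod 2, (0, x, 0) ∈ Q := by
    intro x
    have hx : x ∈ Submodule.span (ZMod 2)
        (insert (Pi.single 0 1) (ends nbhd '' (K : Set (Edge L)))) :=
      span_ends h2 hc 0 ▸ Submodule.mem_top
    induction hx using Submodule.span_induction with
    | mem x hx =>
      rcases hx with rfl | ⟨j, hj, rfl⟩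
      · exact Submodule.mem_sup_right (Submodule.subset_span rfl)
      · have h := Q.sub_mem (hF (Pi.single j 1)) (h3 fun i => w i j)
        rw [hsingle] at h
        convert h using 1
        refine Prod.ext ?_ (Prod.ext ?_ ?_)
        · ext k
          have : (k : Edge L) ≠ j := fun h => Finset.disjoint_left.1 hd hj (h ▸ k.2)
          simp [this]
        · simp
        · simp
    | zero => exact Q.zero_mem
    | add x y _ _ hx hy => simpa using Q.add_mem hx hy
    | smul c x _ hx => simpa using Q.smul_mem c hx
  have h5 : Q = ⊤ := by
    rw [eq_top_iff]
    rintro ⟨r, x, f⟩ -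
    set y : Edge L → ZMod 2 := fun k => if h : k ∈ K' then r ⟨k, h⟩ else 0
    have h := Q.add_mem (hF y) (Q.add_mem (h4 (x - fun p => ind (nbhd p) ⬝ᵥ y))
      (h3 (f - fun i => w i ⬝ᵥ y)))
    convert h using 1
    refine Prod.ext ?_ (Prod.ext ?_ ?_)
    · ext k
      simp [F, pairing, y]
    · simp [F, pairing]
    · simp [F, pairing]
  have h6 := Submodule.finrank_add_le_finrank_add_finrank (LinearMap.range F)
    (Submodule.span (ZMod 2) {(0, Pi.single 0 1, 0)})
  rw [← hQ, h5, finrank_top] at h6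
  have h7 : Module.finrank (ZMod 2) (Submodule.span (ZMod 2)
      {((0, Pi.single 0 1, 0) : (K' → ZMod 2) × (Node L → ZMod 2) × (Fin 2 → ZMod 2))}) ≤ 1 :=
    (finrank_span_le_card _).trans (by simp)
  simp only [Module.finrank_prod, Module.finrank_fintype_fun_eq_card, Fintype.card_coe,
    Fintype.card_fin] at h6
  have h8 := LinearMap.finrank_range_add_finrank_ker F
  have h9 := card_node_le h2' hc'
  rw [Module.finrank_fintype_fun_eq_card, Fintype.card_sum] at h8
  rw [← LinearMap.ker_eq_bot, ← Submodule.finrank_eq_zero (R := ZMod 2)]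
  omega

/-- Dual to `pairing_injective`: a functional that kills all generators is the pairing with a vector
in the kernel, hence zero. -/
theorem span_eq_top {nbhd nbhd' : Node L → Finset (Edge L)} {K K' : Finset (Edge L)}
    (h2 : TwoEnds nbhd) (h2' : TwoEnds nbhd') (hc : (linkGraph nbhd K).Connected)
    (hc' : (linkGraph nbhd' K').Connected) (hd : Disjoint K K') {u w : Fin 2 → Edge L → ZMod 2}
    (hu : ∀ i, ∀ k ∈ K', u i k = 0) (hun : ∀ i p, ind (nbhd p) ⬝ᵥ u i = 0)
    (huw : ∀ i k, w k ⬝ᵥ u i = if i = k then 1 else 0) :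
    Submodule.span (ZMod 2) ((fun k => ind {k}) '' (K' : Set (Edge L)) ∪
      Set.range (fun p => ind (nbhd p)) ∪ Set.range w) = ⊤ := by
  by_contra hne
  obtain ⟨f, hf0, hf⟩ := Submodule.exists_le_ker_of_lt_top _ (lt_top_iff_ne_top.2 hne)
  set x : Edge L → ZMod 2 := fun k => f (Pi.single k 1) with hx
  have hfx : ∀ v, f v = v ⬝ᵥ x := by
    intro v
    rw [LinearMap.pi_apply_eq_sum_univ f v, dotProduct]
    refine Finset.sum_congr rfl fun k _ => ?_
    rw [smul_eq_mul, hx]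
    congr 2
    ext j
    simp [Pi.single_apply, eq_comm]
  have h0 : ∀ v ∈ ((fun k => ind {k}) '' (K' : Set (Edge L)) ∪
      Set.range (fun p => ind (nbhd p)) ∪ Set.range w), v ⬝ᵥ x = 0 := by
    intro v hv
    rw [← hfx]
    exact hf (Submodule.subset_span hv)
  have hx0 : x = 0 := by
    apply pairing_injective h2 h2' hc hc' hd hu hun huw
    rw [map_zero]
    refine Prod.ext ?_ (Prod.ext ?_ ?_)
    · ext k
      have := h0 _ (Or.inl (Or.inl ⟨k, k.2, rfl⟩))
      beta_reduce at this
      rw [ind_singleton, single_one_dotProduct] at this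
      exact this
    · ext p
      exact h0 _ (Or.inl (Or.inr ⟨p, rfl⟩))
    · ext i
      exact h0 _ (Or.inr ⟨i, rfl⟩)
  apply hf0
  ext1 k
  ext
  simpa [hx] using congrFun hx0 k

/-! ### Commutation relations: the Hamiltonian, node operators and commutants. -/

theorem isHermitian_onSites {M : Matrix (Fin 2) (Fin 2) ℂ} (hM : M.IsHermitian)
    (A : Finset (Edge L)) : (onSites A M).IsHermitian := by
  rw [onSites_eq_pauli]
  exact isHermitian_pauli hM _

theorem isHermitian_hamiltonian : (hamiltonian L).IsHermitian := by
  refine IsHermitian.sub (IsHermitian.neg ?_) ?_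
  · rw [IsHermitian, conjTranspose_sum]
    exact Finset.sum_congr rfl fun s _ => isHermitian_onSites isHermitian_pauliX _
  · rw [IsHermitian, conjTranspose_sum]
    exact Finset.sum_congr rfl fun s _ => isHermitian_onSites isHermitian_pauliZ _

theorem commute_hamiltonian_pauliX {u : Edge L → ZMod 2} (h : ∀ p, ind (plaq p) ⬝ᵥ u = 0) :
    Commute (hamiltonian L) (pauli pauliX u) := by
  refine Commute.sub_left (Commute.neg_left (Commute.sum_left _ _ _ fun s _ => ?_))
    (Commute.sum_left _ _ _ fun p _ => ?_)
  · rw [onSites_eq_pauli]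
    exact pauli_commute pauliX_mul_self _ _
  · rw [onSites_eq_pauli]
    exact (commute_pauliX_pauliZ (h p)).symm

theorem commute_hamiltonian_pauliZ {v : Edge L → ZMod 2} (h : ∀ s, v ⬝ᵥ ind (star s) = 0) :
    Commute (hamiltonian L) (pauli pauliZ v) := by
  refine Commute.sub_left (Commute.neg_left (Commute.sum_left _ _ _ fun s _ => ?_))
    (Commute.sum_left _ _ _ fun p _ => ?_)
  · rw [onSites_eq_pauli]
    exact commute_pauliX_pauliZ (h s)
  · rw [onSites_eq_pauli]
    exact pauli_commute pauliZ_mul_self _ _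

/-- Two operators that commute or anticommute. -/
def CommOrAnti (U T : Op L) : Prop := U * T = T * U ∨ U * T = -(T * U)

theorem CommOrAnti.mul {U T T' : Op L} (h : CommOrAnti U T) (h' : CommOrAnti U T') :
    CommOrAnti U (T * T') := by
  rcases h with h | h <;> rcases h' with h' | h'
  · left; rw [← mul_assoc, h, mul_assoc, h', mul_assoc]
  · right; rw [← mul_assoc, h, mul_assoc, h', mul_neg, mul_assoc]
  · right; rw [← mul_assoc, h, neg_mul, mul_assoc, h', mul_assoc]
  · left; rw [← mul_assoc, h, neg_mul, mul_assoc, h', mul_neg, neg_neg, mul_assoc]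

theorem CommOrAnti.smul {U T : Op L} (h : CommOrAnti U T) (c : ℂ) : CommOrAnti U (c • T) := by
  rcases h with h | h
  · left; rw [mul_smul_comm, h, smul_mul_assoc]
  · right; rw [mul_smul_comm, h, smul_mul_assoc, smul_neg]

theorem commOrAnti_pauliX_pauliZ (u v : Edge L → ZMod 2) :
    CommOrAnti (pauli pauliX u) (pauli pauliZ v) := by
  rw [CommOrAnti, pauliX_pauliZ]
  rcases zmod_two_cases (v ⬝ᵥ u) with h | h <;> simp [h]

theorem commOrAnti_pauliZ_pauliX (v u : Edge L → ZMod 2) :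
    CommOrAnti (pauli pauliZ v) (pauli pauliX u) := by
  rw [CommOrAnti, pauliZ_pauliX]
  rcases zmod_two_cases (v ⬝ᵥ u) with h | h <;> simp [h]

theorem exists_ne_ne (hL : 2 ≤ L) (a b : Node L) : ∃ r, r ≠ a ∧ r ≠ b := by
  by_contra! h
  have h1 : (Finset.univ : Finset (Node L)) ⊆ {a, b} := by
    intro r _
    by_cases hr : r = a
    · simp [hr]
    · simp [h r hr]
  have h2 := (Finset.card_le_card h1).trans Finset.card_le_two
  rw [Finset.card_univ, Fintype.card_prod, ZMod.card] at h2
  nlinarith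

/-- Conjugation by `S` turns `x + y` into `y - x`, and half the difference of the two is `x`. -/
theorem commute_of_commute_add {x y S A : Op L} (hxy : Commute (x + y) A) (hS : Commute S A)
    (hS2 : S * S = 1) (hx : S * x = -(x * S)) (hy : S * y = y * S) : Commute x A := by
  have h1 : Commute (S * (x + y) * S) A := (hS.mul_left hxy).mul_left hS
  have h2 : S * (x + y) * S = y - x := by
    rw [mul_add, hx, hy, add_mul, neg_mul, mul_assoc, mul_assoc, hS2]
    simp [sub_eq_neg_add]
  have h3 : x = (1 / 2 : ℂ) • ((x + y) - S * (x + y) * S) := by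
    rw [h2, show x + y - (y - x) = (2 : ℂ) • x by rw [two_smul]; abel, smul_smul]
    norm_num
  rw [h3]
  exact (hxy.sub_left h1).smul_left _

/-- An operator that commutes with the edge operators of a connected set of edges, and with the sum
of the two node operators at each of these edges, commutes with all node operators. -/
theorem commute_node_of_connected (hL : 2 ≤ L) {nbhd : Node L → Finset (Edge L)}
    (h2 : TwoEnds nbhd) {K : Finset (Edge L)} (hc : (linkGraph nbhd K).Connected)
    {N : Node L → Op L} {S : Edge L → Op L} {A : Op L} (hS2 : ∀ j, S j * S j = 1)
    (hanti : ∀ j p, j ∈ nbhd p → S j * N p = -(N p * S j))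
    (hcomm : ∀ j p, j ∉ nbhd p → S j * N p = N p * S j) (hSA : ∀ j ∈ K, Commute (S j) A)
    (hN : ∀ j ∈ K, ∀ a b, a ≠ b → j ∈ nbhd a → j ∈ nbhd b → Commute (N a + N b) A)
    (p : Node L) : Commute (N p) A := by
  by_contra hp
  -- Knowing the sum over each edge, one commuting node operator would propagate along `K` to all
  -- the others.
  have hall : ∀ q, ¬ Commute (N q) A := by
    intro q hq
    refine hp (linkGraph_induction hc (P := fun p => Commute (N p) A) hq ?_ p)
    intro a b hab j hj ha hb h
    simpa using (hN j hj a b hab ha hb).sub_left h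
  obtain ⟨a, hpa, j, hj, hjp, hja⟩ : ∃ a, p ≠ a ∧ ∃ j ∈ K, j ∈ nbhd p ∧ j ∈ nbhd a := by
    by_contra! hno
    obtain ⟨r, hr, -⟩ := exists_ne_ne hL p p
    refine hr (linkGraph_induction hc (P := fun q => q = p) rfl ?_ r)
    rintro q s hqs k hk hq hs rfl
    exact absurd hs (hno s hqs k hk hq)
  -- The edge joining `p` and `a` flips both of their operators and cannot separate them. A third
  -- node exists, so some edge of `K` leaves `{p, a}`; it flips just one of the two and isolates it
  -- from the sum.
  obtain ⟨r, hr⟩ := exists_ne_ne hL p a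
  refine absurd (linkGraph_induction hc (P := fun q => q = p ∨ q = a) (Or.inl rfl) ?_ r)
    (not_or.2 hr)
  intro q s hqs k hk hkq hks hq
  by_contra hs
  rw [not_or] at hs
  rcases hq with rfl | rfl
  · refine hall q (commute_of_commute_add (y := N a) (hN j hj q a hpa hjp hja) (hSA k hk) (hS2 k)
      (hanti k q hkq) (hcomm k a ?_))
    rw [h2.iff hqs hkq hks]
    exact not_or.2 ⟨hpa.symm, Ne.symm hs.2⟩
  · refine hall q (commute_of_commute_add (y := N p) (hN j hj q p hpa.symm hja hjp) (hSA k hk)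
      (hS2 k) (hanti k q hkq) (hcomm k p ?_))
    rw [h2.iff hqs hkq hks]
    exact not_or.2 ⟨hpa, Ne.symm hs.1⟩

/-- The commutator of the Hamiltonian `H' - ∑ N_p` with an edge operator determines the sum of the
node operators at the edge. -/
theorem commute_add_of_commute_commutator {nbhd : Node L → Finset (Edge L)} (h2 : TwoEnds nbhd)
    {N : Node L → Op L} {S : Edge L → Op L} {A H' : Op L} (hS2 : ∀ j, S j * S j = 1)
    (hanti : ∀ j p, j ∈ nbhd p → S j * N p = -(N p * S j))
    (hcomm : ∀ j p, j ∉ nbhd p → S j * N p = N p * S j) {j : Edge L} (hH' : Commute H' (S j))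
    (hSA : Commute (S j) A)
    (h : Commute ((H' - ∑ p, N p) * S j - S j * (H' - ∑ p, N p)) A) {a b : Node L} (hab : a ≠ b)
    (ha : j ∈ nbhd a) (hb : j ∈ nbhd b) : Commute (N a + N b) A := by
  have e1 : (H' - ∑ p, N p) * S j - S j * (H' - ∑ p, N p) = -((2 : ℂ) • ((N a + N b) * S j)) := by
    rw [sub_mul, mul_sub, hH'.eq, sub_sub_sub_cancel_left, Finset.mul_sum, Finset.sum_mul,
      ← Finset.sum_sub_distrib, ← Finset.sum_subset (Finset.subset_univ {a, b}),
      Finset.sum_pair hab, hanti j a ha, hanti j b hb, two_smul, add_mul]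
    · abel
    · intro p _ hp
      rw [hcomm j p, sub_self]
      rw [h2.iff hab ha hb]
      simpa using hp
  have e2 : N a + N b = (-(1 / 2 : ℂ)) •
      (((H' - ∑ p, N p) * S j - S j * (H' - ∑ p, N p)) * S j) := by
    rw [e1, neg_mul, smul_mul_assoc, mul_assoc, hS2, mul_one, smul_neg, smul_smul, ← neg_smul]
    norm_num
  rw [e2]
  exact (h.mul_left hSA).smul_left _

theorem commute_pauli_of_span {M : Matrix (Fin 2) (Fin 2) ℂ} (hM : M * M = 1)
    {s : Set (Edge L → ZMod 2)} (hs : Submodule.span (ZMod 2) s = ⊤) {A : Op L}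
    (h : ∀ u ∈ s, Commute (pauli M u) A) (u : Edge L → ZMod 2) : Commute (pauli M u) A := by
  have hu : u ∈ Submodule.span (ZMod 2) s := by rw [hs]; exact Submodule.mem_top
  induction hu using Submodule.span_induction with
  | mem u hu => exact h u hu
  | zero => rw [pauli_zero]; exact Commute.one_left _
  | add u v _ _ hu hv => rw [pauli_add hM]; exact hu.mul_left hv
  | smul c u _ hu =>
    rcases zmod_two_cases c with rfl | rfl
    · rw [zero_smul, pauli_zero]; exact Commute.one_left _
    · rwa [one_smul]

/-- A Pauli operator that commutes with the loops is a product of elements of the two syndrome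
algebras. -/
theorem exists_pauli_eq_mul {M : Matrix (Fin 2) (Fin 2) ℂ} (hM : M * M = 1)
    {nbhd : Node L → Finset (Edge L)} {K : Finset (Edge L)} {u w : Fin 2 → Edge L → ZMod 2}
    (hspan : Submodule.span (ZMod 2) ((fun k => ind {k}) '' (K : Set (Edge L)) ∪
      Set.range (fun p => ind (nbhd p)) ∪ Set.range w) = ⊤)
    (hu : ∀ i, ∀ k ∈ K, u i k = 0) (hun : ∀ i p, ind (nbhd p) ⬝ᵥ u i = 0)
    (huw : ∀ i k, w k ⬝ᵥ u i = if i = k then 1 else 0) {A₁ A₂ : Subalgebra ℂ (Op L)}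
    (hA₁ : ∀ k ∈ K, pauli M (ind {k}) ∈ A₁) (hA₂ : ∀ p, pauli M (ind (nbhd p)) ∈ A₂)
    (hA : ∀ a ∈ A₁, ∀ e ∈ A₂, Commute a e) {v : Edge L → ZMod 2} (hv : ∀ i, v ⬝ᵥ u i = 0) :
    ∃ a ∈ A₁, ∃ e ∈ A₂, pauli M v = a * e := by
  -- The correction removes the loop components linearly in `v`: it fixes edge and node generators
  -- and kills each `w k`. So the factorisation can be proved on generators; it concerns `v` itself
  -- when all `v ⬝ᵥ u i` vanish.
  have key : ∀ v : Edge L → ZMod 2,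
      ∃ a ∈ A₁, ∃ e ∈ A₂, pauli M (v + ∑ i, (v ⬝ᵥ u i) • w i) = a * e := by
    intro v
    have hv : v ∈ Submodule.span (ZMod 2) ((fun k => ind {k}) '' (K : Set (Edge L)) ∪
      Set.range (fun p => ind (nbhd p)) ∪ Set.range w) := by rw [hspan]; exact Submodule.mem_top
    induction hv using Submodule.span_induction with
    | mem v hv =>
      rcases hv with (⟨k, hk, rfl⟩ | ⟨p, rfl⟩) | ⟨k, rfl⟩
      · refine ⟨_, hA₁ k hk, 1, one_mem _, ?_⟩
        simp [ind_singleton, hu _ k hk]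
      · exact ⟨1, one_mem _, _, hA₂ p, by simp [hun]⟩
      · exact ⟨1, one_mem _, 1, one_mem _, by simp [huw, CharTwo.add_self_eq_zero, pauli_zero]⟩
    | zero => exact ⟨1, one_mem _, 1, one_mem _, by simp [pauli_zero]⟩
    | add v v' _ _ h h' =>
      obtain ⟨a, ha, e, he, h⟩ := h
      obtain ⟨a', ha', e', he', h'⟩ := h'
      refine ⟨a * a', mul_mem ha ha', e * e', mul_mem he he', ?_⟩
      have : v + v' + ∑ i, ((v + v') ⬝ᵥ u i) • w i =
          (v + ∑ i, (v ⬝ᵥ u i) • w i) + (v' + ∑ i, (v' ⬝ᵥ u i) • w i) := by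
        simp only [add_dotProduct, add_smul, Finset.sum_add_distrib]
        abel
      rw [this, pauli_add hM, h, h', (hA a' ha' e he).symm.mul_mul_mul_comm]
    | smul c v _ h =>
      rcases zmod_two_cases c with rfl | rfl
      · exact ⟨1, one_mem _, 1, one_mem _, by simp [pauli_zero]⟩
      · simpa using h
  simpa [hv] using key v

/-- A fixed point of the conjugations by involutions that preserve each element of `s` up to sign
lies in the span of the fixed points in `s`. -/
theorem mem_span_of_commute {ι : Type*} (U : ι → Op L) (hU : ∀ i, U i * U i = 1)
    {s : Set (Op L)} (hs : ∀ x ∈ s, ∀ i, CommOrAnti (U i) x) {T : Op L}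
    (hT : T ∈ Submodule.span ℂ s) (hUT : ∀ i, Commute (U i) T) (I : Finset ι) :
    T ∈ Submodule.span ℂ {x ∈ s | ∀ i ∈ I, Commute (U i) x} := by
  classical
  induction I using Finset.induction_on with
  | empty => simpa using hT
  | insert i I _ ih =>
    -- The map `T ↦ T + U T U` doubles the elements of `s` that commute with `U`, kills those that
    -- anticommute, and doubles the given fixed point.
    have h1 : ∀ T ∈ Submodule.span ℂ {x ∈ s | ∀ i ∈ I, Commute (U i) x},
        T + U i * T * U i ∈ Submodule.span ℂ {x ∈ s | ∀ k ∈ insert i I, Commute (U k) x} := by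
      intro T hT
      induction hT using Submodule.span_induction with
      | mem x hx =>
        rcases hs x hx.1 i with h | h
        · rw [h, mul_assoc, hU, mul_one, ← two_smul ℂ x]
          refine Submodule.smul_mem _ _ (Submodule.subset_span ⟨hx.1, fun k hk => ?_⟩)
          rcases Finset.mem_insert.1 hk with rfl | hk
          · exact h
          · exact hx.2 k hk
        · rw [h, neg_mul, mul_assoc, hU, mul_one, add_neg_cancel]
          exact Submodule.zero_mem _
      | zero => simp
      | add x y _ _ hx hy =>
        convert Submodule.add_mem _ hx hy using 1
        rw [mul_add, add_mul]
        abel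
      | smul c x _ hx =>
        convert Submodule.smul_mem _ c hx using 1
        rw [mul_smul_comm, smul_mul_assoc, smul_add]
    have h2 := h1 T ih
    rw [(hUT i).eq, mul_assoc, hU, mul_one, ← two_smul ℂ T] at h2
    exact (Submodule.smul_mem_iff _ two_ne_zero).1 h2

theorem onSites_mul_self {M : Matrix (Fin 2) (Fin 2) ℂ} (hM : M * M = 1) (A : Finset (Edge L)) :
    onSites A M * onSites A M = 1 := by
  rw [onSites_eq_pauli, pauli_mul_self hM]

/-! ### Logical operators and their commutant, the trivial block. -/

namespace Layout

variable (D : Layout L)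

/-- The logical operators `X_i` and `Z_i`. -/
def logical : Fin 2 ⊕ Fin 2 → Op L := Sum.elim D.logX D.logZ

theorem logX_eq (i : Fin 2) : D.logX i = pauli pauliX (ind (D.loopX i)) := onSites_eq_pauli _ _

theorem logZ_eq (i : Fin 2) : D.logZ i = pauli pauliZ (ind (D.loopZ i)) := onSites_eq_pauli _ _

theorem logical_mul_self (k : Fin 2 ⊕ Fin 2) : D.logical k * D.logical k = 1 := by
  rcases k with i | i
  · exact onSites_mul_self pauliX_mul_self _
  · exact onSites_mul_self pauliZ_mul_self _

theorem isHermitian_logical (k : Fin 2 ⊕ Fin 2) : (D.logical k).IsHermitian := by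
  rcases k with i | i
  · exact isHermitian_onSites isHermitian_pauliX _
  · exact isHermitian_onSites isHermitian_pauliZ _

theorem ind_plaq_dotProduct_loopX (i : Fin 2) (p : Node L) :
    ind (plaq p) ⬝ᵥ ind (D.loopX i) = 0 := by
  rw [ind_dotProduct_ind, Finset.inter_comm]
  exact (ZMod.natCast_eq_zero_iff_even).2 (D.even_loopX i p)

theorem ind_star_dotProduct_loopZ (i : Fin 2) (s : Node L) :
    ind (star s) ⬝ᵥ ind (D.loopZ i) = 0 := by
  rw [ind_dotProduct_ind, Finset.inter_comm]
  exact (ZMod.natCast_eq_zero_iff_even).2 (D.even_loopZ i s)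

theorem loopX_dotProduct_loopZ (i k : Fin 2) :
    ind (D.loopX i) ⬝ᵥ ind (D.loopZ k) = if i = k then 1 else 0 := by
  rw [ind_dotProduct_ind]
  split_ifs with h
  · exact (ZMod.natCast_eq_one_iff_odd).2 ((D.odd_inter i k).2 h)
  · exact (ZMod.natCast_eq_zero_iff_even).2 (Nat.not_odd_iff_even.1 (mt (D.odd_inter i k).1 h))

theorem loopX_apply (i : Fin 2) {k : Edge L} (hk : k ∈ D.comb) : ind (D.loopX i) k = 0 := by
  simpa [ind] using fun h => Finset.disjoint_left.1 (D.disjoint_loopX i) h hk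

theorem loopZ_apply (i : Fin 2) {k : Edge L} (hk : k ∈ D.snake) : ind (D.loopZ i) k = 0 := by
  simpa [ind] using fun h => Finset.disjoint_left.1 (D.disjoint_loopZ i) h hk

theorem commute_hamiltonian_logical (k : Fin 2 ⊕ Fin 2) :
    Commute (hamiltonian L) (D.logical k) := by
  rcases k with i | i
  · change Commute _ (D.logX i)
    rw [logX_eq]
    exact commute_hamiltonian_pauliX (D.ind_plaq_dotProduct_loopX i)
  · change Commute _ (D.logZ i)
    rw [logZ_eq]
    exact commute_hamiltonian_pauliZ fun s => by
      rw [dotProduct_comm]; exact D.ind_star_dotProduct_loopZ i s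

/-- The roles cross: the snake is completed by stars, whose unit vectors are reached along the comb,
while connectedness of the snake supplies the bound on its size. -/
theorem span_pauliX_generators (hL : 2 ≤ L) :
    Submodule.span (ZMod 2) ((fun k => ind {k}) '' (D.snake : Set (Edge L)) ∪
      Set.range (fun p => ind (star p)) ∪ Set.range fun i => ind (D.loopX i)) = ⊤ :=
  span_eq_top (twoEnds_star hL) (twoEnds_plaq hL) D.comb_connected D.snake_connected
    D.disjoint_snake_comb.symm (fun i _ hk => D.loopZ_apply i hk) D.ind_star_dotProduct_loopZ
    fun i k => by rw [loopX_dotProduct_loopZ]; simp [eq_comm]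

theorem span_pauliZ_generators (hL : 2 ≤ L) :
    Submodule.span (ZMod 2) ((fun k => ind {k}) '' (D.comb : Set (Edge L)) ∪
      Set.range (fun p => ind (plaq p)) ∪ Set.range fun i => ind (D.loopZ i)) = ⊤ :=
  span_eq_top (twoEnds_plaq hL) (twoEnds_star hL) D.snake_connected D.comb_connected
    D.disjoint_snake_comb (fun i _ hk => D.loopX_apply i hk) D.ind_plaq_dotProduct_loopX
    fun i k => by rw [dotProduct_comm, loopX_dotProduct_loopZ]

theorem commute_onSites_of_notMem {u : Edge L → ZMod 2} {j : Edge L} (h : u j = 0) :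
    Commute (onSites {j} pauliX) (pauli pauliZ u) ∧
      Commute (onSites {j} pauliZ) (pauli pauliX u) := by
  simp only [onSites_eq_pauli, ind_singleton]
  exact ⟨commute_pauliX_pauliZ (by simpa using h), (commute_pauliX_pauliZ (by simpa using h)).symm⟩

theorem commute_snake_logical {j : Edge L} (hj : j ∈ D.snake) (k : Fin 2 ⊕ Fin 2) :
    Commute (onSites {j} pauliX) (D.logical k) := by
  rcases k with i | i
  · change Commute _ (D.logX i)
    rw [logX_eq, onSites_eq_pauli]
    exact pauli_commute pauliX_mul_self _ _
  · change Commute _ (D.logZ i)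
    rw [logZ_eq]
    exact (commute_onSites_of_notMem (D.loopZ_apply i hj)).1

theorem commute_comb_logical {j : Edge L} (hj : j ∈ D.comb) (k : Fin 2 ⊕ Fin 2) :
    Commute (onSites {j} pauliZ) (D.logical k) := by
  rcases k with i | i
  · change Commute _ (D.logX i)
    rw [logX_eq]
    exact (commute_onSites_of_notMem (D.loopX_apply i hj)).2
  · change Commute _ (D.logZ i)
    rw [logZ_eq, onSites_eq_pauli]
    exact pauli_commute pauliZ_mul_self _ _

theorem commute_algM_logical {a : Op L} (ha : a ∈ D.algM) (k : Fin 2 ⊕ Fin 2) :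
    Commute (D.logical k) a := by
  refine Algebra.commute_of_mem_adjoin_of_forall_mem_commute ha fun b hb => ?_
  rcases hb with ⟨p, rfl⟩ | ⟨j, hj, rfl⟩
  · change Commute _ (onSites (plaq p) pauliZ)
    rw [onSites_eq_pauli]
    rcases k with i | i
    · change Commute (D.logX i) _
      rw [logX_eq]
      exact commute_pauliX_pauliZ (D.ind_plaq_dotProduct_loopX i p)
    · change Commute (D.logZ i) _
      rw [logZ_eq]
      exact pauli_commute pauliZ_mul_self _ _
  · exact (D.commute_snake_logical hj k).symm

theorem commute_algE_logical {e : Op L} (he : e ∈ D.algE) (k : Fin 2 ⊕ Fin 2) :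
    Commute (D.logical k) e := by
  refine Algebra.commute_of_mem_adjoin_of_forall_mem_commute he fun b hb => ?_
  rcases hb with ⟨s, rfl⟩ | ⟨j, hj, rfl⟩
  · change Commute _ (onSites (star s) pauliX)
    rw [onSites_eq_pauli]
    rcases k with i | i
    · change Commute (D.logX i) _
      rw [logX_eq]
      exact pauli_commute pauliX_mul_self _ _
    · change Commute (D.logZ i) _
      rw [logZ_eq]
      exact (commute_pauliX_pauliZ (by
        rw [dotProduct_comm]; exact D.ind_star_dotProduct_loopZ i s)).symm
  · exact (D.commute_comb_logical hj k).symm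

/-- On generators this rests on two facts: stars and plaquettes overlap evenly, and snake and comb
are disjoint. -/
theorem commute_algM_algE (hL : 2 ≤ L) {a e : Op L} (ha : a ∈ D.algM) (he : e ∈ D.algE) :
    Commute a e := by
  refine Algebra.commute_of_mem_adjoin_of_forall_mem_commute he fun b hb => Commute.symm ?_
  refine Algebra.commute_of_mem_adjoin_of_forall_mem_commute ha fun c hc => ?_
  rcases hb with ⟨s, rfl⟩ | ⟨j, hj, rfl⟩ <;> rcases hc with ⟨p, rfl⟩ | ⟨k, hk, rfl⟩ <;>
    simp only [onSites_eq_pauli]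
  · exact commute_pauliX_pauliZ (ind_plaq_dotProduct_ind_star hL p s)
  · exact pauli_commute pauliX_mul_self _ _
  · exact pauli_commute pauliZ_mul_self _ _
  · refine (commute_pauliX_pauliZ ?_).symm
    have : j ≠ k := fun h => Finset.disjoint_left.1 D.disjoint_snake_comb hk (h ▸ hj)
    simp [ind_singleton, this]

theorem mem_block_I {T : Op L} : T ∈ D.block .I .I ↔
    T ∈ Submodule.span ℂ {T | ∃ a ∈ D.algM, ∃ e ∈ D.algE, T = a * e} := by
  simp [block, logOp]

theorem commute_logical_of_mem_block {T : Op L} (hT : T ∈ D.block .I .I) (k : Fin 2 ⊕ Fin 2) :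
    Commute (D.logical k) T := by
  rw [mem_block_I] at hT
  induction hT using Submodule.span_induction with
  | mem x hx =>
    obtain ⟨a, ha, e, he, rfl⟩ := hx
    exact (D.commute_algM_logical ha k).mul_right (D.commute_algE_logical he k)
  | zero => exact Commute.zero_right _
  | add x y _ _ hx hy => exact hx.add_right hy
  | smul c x _ hx => exact hx.smul_right c

theorem commOrAnti_logical_pauli (k : Fin 2 ⊕ Fin 2) (u v : Edge L → ZMod 2) :
    CommOrAnti (D.logical k) (pauli pauliX u) ∧ CommOrAnti (D.logical k) (pauli pauliZ v) := by
  rcases k with i | i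
  · change CommOrAnti (D.logX i) _ ∧ CommOrAnti (D.logX i) _
    rw [logX_eq]
    exact ⟨Or.inl (pauli_commute pauliX_mul_self _ _), commOrAnti_pauliX_pauliZ _ _⟩
  · change CommOrAnti (D.logZ i) _ ∧ CommOrAnti (D.logZ i) _
    rw [logZ_eq]
    exact ⟨commOrAnti_pauliZ_pauliX _ _, Or.inl (pauli_commute pauliZ_mul_self _ _)⟩

theorem pauli_mul_pauli_ne_zero (u v : Edge L → ZMod 2) :
    pauli pauliX u * pauli pauliZ v ≠ 0 := by
  intro h
  have h1 := congrArg (fun T => pauli pauliX u * T * pauli pauliZ v) h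
  simp only [mul_zero, zero_mul] at h1
  rw [← mul_assoc, pauli_mul_self pauliX_mul_self, one_mul, pauli_mul_self pauliZ_mul_self] at h1
  exact one_ne_zero h1

theorem eq_zero_of_sgn_smul_eq {a : ZMod 2} {T : Op L} (hT : T ≠ 0) (h : sgn a • T = T) :
    a = 0 := by
  rcases zmod_two_cases a with rfl | rfl
  · rfl
  · rw [sgn_one, neg_one_smul] at h
    have h2 : (2 : ℂ) • T = 0 := by
      rw [two_smul]
      nth_rw 1 [← h]
      exact neg_add_cancel T
    exact absurd ((smul_eq_zero.1 h2).resolve_left two_ne_zero) hT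

/-- The trivial block is the commutant of the logical operators. -/
theorem mem_block_of_commute (hL : 2 ≤ L) {T : Op L} (hT : ∀ k, Commute (D.logical k) T) :
    T ∈ D.block .I .I := by
  have hT' : T ∈ Submodule.span ℂ
      (Set.range fun w : (Edge L → ZMod 2) × (Edge L → ZMod 2) =>
        pauli pauliX w.1 * pauli pauliZ w.2) := by
    rw [span_pauli]; exact Submodule.mem_top
  -- The Pauli operators span everything and each is even or odd under each logical operator, so
  -- only the even ones are needed for `T`.
  have h := mem_span_of_commute D.logical D.logical_mul_self (by
    rintro _ ⟨w, rfl⟩ k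
    exact (D.commOrAnti_logical_pauli k w.1 w.2).1.mul (D.commOrAnti_logical_pauli k w.1 w.2).2)
    hT' hT Finset.univ
  rw [mem_block_I]
  refine Submodule.span_le.2 ?_ h
  rintro _ ⟨⟨⟨u, v⟩, rfl⟩, hc⟩
  have hu : ∀ i, u ⬝ᵥ ind (D.loopZ i) = 0 := by
    intro i
    have h1 := (hc (Sum.inr i) (Finset.mem_univ _)).eq
    change D.logZ i * _ = _ * D.logZ i at h1
    rw [logZ_eq, ← mul_assoc, pauliZ_pauliX, smul_mul_assoc, mul_assoc, mul_assoc,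
      (pauli_commute pauliZ_mul_self _ v).eq, ← smul_mul_assoc] at h1
    rw [dotProduct_comm]
    refine eq_zero_of_sgn_smul_eq (pauli_mul_pauli_ne_zero u (v + ind (D.loopZ i))) ?_
    rw [pauli_add pauliZ_mul_self]
    simpa only [smul_mul_assoc] using h1
  have hv : ∀ i, v ⬝ᵥ ind (D.loopX i) = 0 := by
    intro i
    have h1 := (hc (Sum.inl i) (Finset.mem_univ _)).eq
    change D.logX i * _ = _ * D.logX i at h1
    rw [logX_eq, mul_assoc, pauliZ_pauliX, mul_smul_comm, ← mul_assoc, ← mul_assoc,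
      (pauli_commute pauliX_mul_self _ u).eq, ← pauli_add pauliX_mul_self] at h1
    exact eq_zero_of_sgn_smul_eq (pauli_mul_pauli_ne_zero _ v) h1.symm
  have hME : ∀ a ∈ D.algM, ∀ e ∈ D.algE, Commute a e :=
    fun a ha e he => D.commute_algM_algE hL ha he
  -- In the `X` part the edges are magnetic and the stars electric; in the `Z` part below, the edges
  -- are electric and the plaquettes magnetic.
  obtain ⟨a, ha, e, he, hX⟩ := exists_pauli_eq_mul (v := u) pauliX_mul_self
    (D.span_pauliX_generators hL) (u := fun i => ind (D.loopZ i)) (fun i _ hk => D.loopZ_apply i hk)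
    D.ind_star_dotProduct_loopZ (fun i k => by rw [loopX_dotProduct_loopZ]; simp [eq_comm])
    (A₁ := D.algM) (A₂ := D.algE)
    (fun k hk => Algebra.subset_adjoin (Or.inr ⟨k, hk, onSites_eq_pauli _ _⟩))
    (fun p => Algebra.subset_adjoin (Or.inl ⟨p, onSites_eq_pauli _ _⟩)) hME hu
  obtain ⟨e', he', a', ha', hZ⟩ := exists_pauli_eq_mul (v := v) pauliZ_mul_self
    (D.span_pauliZ_generators hL) (u := fun i => ind (D.loopX i)) (fun i _ hk => D.loopX_apply i hk)
    D.ind_plaq_dotProduct_loopX (fun i k => by rw [dotProduct_comm, loopX_dotProduct_loopZ])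
    (A₁ := D.algE) (A₂ := D.algM)
    (fun k hk => Algebra.subset_adjoin (Or.inr ⟨k, hk, onSites_eq_pauli _ _⟩))
    (fun p => Algebra.subset_adjoin (Or.inl ⟨p, onSites_eq_pauli _ _⟩))
    (fun e he a ha => (hME a ha e he).symm) hv
  refine Submodule.subset_span ⟨a * a', mul_mem ha ha', e * e', mul_mem he he', ?_⟩
  change pauli pauliX u * pauli pauliZ v = _
  rw [hX, hZ, ← (hME a' ha' e' he').eq, (hME a' ha' e he).symm.mul_mul_mul_comm]

end Layout

/-! ### Kernel and gap of the local generator on the trivial block. -/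

theorem gnsNonneg_onSites (β : ℝ) {M : Matrix (Fin 2) (Fin 2) ℂ} (hM : M.IsHermitian)
    (A : Finset (Edge L)) :
    GNSNonneg (gibbsState (hamiltonian L) β) (-davies (hamiltonian L) β (onSites A M)) :=
  gnsNonneg_neg_davies isHermitian_hamiltonian (isHermitian_onSites hM A) β

theorem commute_plaq_of_connected (hL : 2 ≤ L) {K : Finset (Edge L)}
    (hc : (linkGraph plaq K).Connected) {A : Op L} (hS : ∀ j ∈ K, Commute (onSites {j} pauliX) A)
    (hD : ∀ j ∈ K, Commute (hamiltonian L * onSites {j} pauliX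
      - onSites {j} pauliX * hamiltonian L) A) (p : Node L) :
    Commute (onSites (plaq p) pauliZ) A := by
  have hS2 : ∀ j : Edge L, onSites {j} pauliX * onSites {j} pauliX = 1 :=
    fun j => onSites_mul_self pauliX_mul_self _
  have hanti : ∀ (j : Edge L) (p : Node L), j ∈ plaq p →
      onSites {j} pauliX * onSites (plaq p) pauliZ =
        -(onSites (plaq p) pauliZ * onSites {j} pauliX) := by
    intro j p h
    simp only [onSites_eq_pauli, ind_singleton]
    rw [pauliX_pauliZ, dotProduct_single_one, ind, if_pos h, sgn_one, neg_one_smul]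
  have hcomm : ∀ (j : Edge L) (p : Node L), j ∉ plaq p →
      onSites {j} pauliX * onSites (plaq p) pauliZ =
        onSites (plaq p) pauliZ * onSites {j} pauliX := by
    intro j p h
    simp only [onSites_eq_pauli, ind_singleton]
    rw [pauliX_pauliZ, dotProduct_single_one, ind, if_neg h, sgn_zero, one_smul]
  refine commute_node_of_connected hL (twoEnds_plaq hL) hc (S := fun j => onSites {j} pauliX)
    hS2 hanti hcomm hS ?_ p
  intro j hj a b hab ha hb
  refine commute_add_of_commute_commutator (twoEnds_plaq hL) (S := fun j => onSites {j} pauliX)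
    (N := fun p => onSites (plaq p) pauliZ)
    hS2 hanti hcomm (H' := -∑ s, onSites (star s) pauliX) ?_ (hS j hj) (hD j hj) hab ha hb
  refine Commute.neg_left (Commute.sum_left _ _ _ fun s _ => ?_)
  simp only [onSites_eq_pauli]
  exact pauli_commute pauliX_mul_self _ _

theorem commute_star_of_connected (hL : 2 ≤ L) {K : Finset (Edge L)}
    (hc : (linkGraph star K).Connected) {A : Op L} (hS : ∀ j ∈ K, Commute (onSites {j} pauliZ) A)
    (hD : ∀ j ∈ K, Commute (hamiltonian L * onSites {j} pauliZ
      - onSites {j} pauliZ * hamiltonian L) A) (s : Node L) :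
    Commute (onSites (star s) pauliX) A := by
  have hS2 : ∀ j : Edge L, onSites {j} pauliZ * onSites {j} pauliZ = 1 :=
    fun j => onSites_mul_self pauliZ_mul_self _
  have hanti : ∀ (j : Edge L) (p : Node L), j ∈ star p →
      onSites {j} pauliZ * onSites (star p) pauliX =
        -(onSites (star p) pauliX * onSites {j} pauliZ) := by
    intro j p h
    simp only [onSites_eq_pauli, ind_singleton]
    rw [pauliZ_pauliX, single_one_dotProduct, ind, if_pos h, sgn_one, neg_one_smul]
  have hcomm : ∀ (j : Edge L) (p : Node L), j ∉ star p →
      onSites {j} pauliZ * onSites (star p) pauliX =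
        onSites (star p) pauliX * onSites {j} pauliZ := by
    intro j p h
    simp only [onSites_eq_pauli, ind_singleton]
    rw [pauliZ_pauliX, single_one_dotProduct, ind, if_neg h, sgn_zero, one_smul]
  refine commute_node_of_connected hL (twoEnds_star hL) hc (S := fun j => onSites {j} pauliZ)
    hS2 hanti hcomm hS ?_ s
  intro j hj a b hab ha hb
  have hH : hamiltonian L = -(∑ p, onSites (plaq p) pauliZ) - ∑ s, onSites (star s) pauliX := by
    rw [hamiltonian]; abel
  have hD' := hD j hj
  rw [hH] at hD'
  refine commute_add_of_commute_commutator (twoEnds_star hL) (S := fun j => onSites {j} pauliZ)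
    (N := fun p => onSites (star p) pauliX)
    hS2 hanti hcomm (H' := -∑ p, onSites (plaq p) pauliZ) ?_ (hS j hj) hD' hab ha hb
  refine Commute.neg_left (Commute.sum_left _ _ _ fun s _ => ?_)
  simp only [onSites_eq_pauli]
  exact pauli_commute pauliZ_mul_self _ _

namespace Layout

variable (D : Layout L) (β : ℝ)

local notation "ρ" => gibbsState (hamiltonian L)

theorem gnsNonneg_genLocal : GNSNonneg (ρ β) (-D.genLocal β) :=
  GNSNonneg.neg_add (GNSNonneg.neg_sum fun _ _ => gnsNonneg_onSites β isHermitian_pauliX _)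
    (GNSNonneg.neg_sum fun _ _ => gnsNonneg_onSites β isHermitian_pauliZ _)

theorem genGlobal_eq :
    D.genGlobal β = ∑ k, davies (hamiltonian L) β (D.logical k) := by
  rw [Fintype.sum_sum_type, genGlobal, Finset.sum_add_distrib]
  rfl

theorem gnsNonneg_logical (k : Fin 2 ⊕ Fin 2) :
    GNSNonneg (ρ β) (-davies (hamiltonian L) β (D.logical k)) :=
  gnsNonneg_neg_davies isHermitian_hamiltonian (D.isHermitian_logical k) β

theorem gnsNonneg_genGlobal : GNSNonneg (ρ β) (-D.genGlobal β) := by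
  rw [genGlobal_eq]
  exact GNSNonneg.neg_sum fun k _ => D.gnsNonneg_logical β k

/-- The part of the Gibbs sampler with single-site couplings. -/
noncomputable def genSites : Module.End ℂ (Op L) :=
  ∑ j : Edge L, (davies (hamiltonian L) β (onSites {j} pauliX)
      + davies (hamiltonian L) β (onSites {j} pauliY)
      + davies (hamiltonian L) β (onSites {j} pauliZ))

theorem genFull_eq : D.genFull β = genSites β + D.genGlobal β := rfl

theorem gnsNonneg_genSites : GNSNonneg (ρ β) (-genSites β) :=
  GNSNonneg.neg_sum fun _ _ => GNSNonneg.neg_add (GNSNonneg.neg_add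
    (gnsNonneg_onSites β isHermitian_pauliX _) (gnsNonneg_onSites β isHermitian_pauliY _))
    (gnsNonneg_onSites β isHermitian_pauliZ _)

theorem gnsNonneg_genFull : GNSNonneg (ρ β) (-D.genFull β) :=
  GNSNonneg.neg_add (gnsNonneg_genSites β) (D.gnsNonneg_genGlobal β)

theorem davies_logical (k : Fin 2 ⊕ Fin 2) (T : Op L) :
    davies (hamiltonian L) β (D.logical k) T = D.logical k * T * D.logical k - T :=
  davies_involution isHermitian_hamiltonian (D.commute_hamiltonian_logical k)
    (D.isHermitian_logical k) (D.logical_mul_self k) β T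

/-- The single-site generators dominate the snake-and-comb generator. -/
theorem gnsNonneg_genLocal_sub_genSites : GNSNonneg (ρ β) (D.genLocal β - genSites β) := by
  have h : D.genLocal β - genSites β =
      -(∑ j : Edge L, davies (hamiltonian L) β (onSites {j} pauliY)
        + ∑ j ∈ D.snakeᶜ, davies (hamiltonian L) β (onSites {j} pauliX)
        + ∑ j ∈ D.combᶜ, davies (hamiltonian L) β (onSites {j} pauliZ)) := by
    rw [genSites, Finset.sum_add_distrib, Finset.sum_add_distrib, genLocal,
      ← Finset.sum_add_sum_compl D.snake fun j => davies (hamiltonian L) β (onSites {j} pauliX),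
      ← Finset.sum_add_sum_compl D.comb fun j => davies (hamiltonian L) β (onSites {j} pauliZ)]
    abel
  rw [h]
  exact GNSNonneg.neg_add (GNSNonneg.neg_add
    (GNSNonneg.neg_sum fun _ _ => gnsNonneg_onSites β isHermitian_pauliY _)
    (GNSNonneg.neg_sum fun _ _ => gnsNonneg_onSites β isHermitian_pauliX _))
    (GNSNonneg.neg_sum fun _ _ => gnsNonneg_onSites β isHermitian_pauliZ _)

theorem genLocal_mul_left {b : Op L} (hb : Commute (hamiltonian L) b)
    (hX : ∀ j ∈ D.snake, Commute (onSites {j} pauliX) b)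
    (hZ : ∀ j ∈ D.comb, Commute (onSites {j} pauliZ) b) (T : Op L) :
    D.genLocal β (b * T) = b * D.genLocal β T := by
  simp only [genLocal, LinearMap.add_apply, LinearMap.sum_apply, mul_add, Finset.mul_sum]
  congr 1
  · exact Finset.sum_congr rfl fun j hj =>
      davies_mul_left hb (hX j hj) (isHermitian_onSites isHermitian_pauliX _) β T
  · exact Finset.sum_congr rfl fun j hj =>
      davies_mul_left hb (hZ j hj) (isHermitian_onSites isHermitian_pauliZ _) β T

theorem genLocal_mul_right {b : Op L} (hb : Commute (hamiltonian L) b)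
    (hX : ∀ j ∈ D.snake, Commute (onSites {j} pauliX) b)
    (hZ : ∀ j ∈ D.comb, Commute (onSites {j} pauliZ) b) (T : Op L) :
    D.genLocal β (T * b) = D.genLocal β T * b := by
  simp only [genLocal, LinearMap.add_apply, LinearMap.sum_apply, add_mul, Finset.sum_mul]
  congr 1
  · exact Finset.sum_congr rfl fun j hj =>
      davies_mul_right hb (hX j hj) (isHermitian_onSites isHermitian_pauliX _) β T
  · exact Finset.sum_congr rfl fun j hj =>
      davies_mul_right hb (hZ j hj) (isHermitian_onSites isHermitian_pauliZ _) β T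

/-- The local couplings commute with the logical operators, so the generator respects left and right
multiplication by them and preserves their commutant. -/
theorem genLocal_mem_block (hL : 2 ≤ L) {A : Op L} (hA : A ∈ D.block .I .I) :
    D.genLocal β A ∈ D.block .I .I := by
  refine D.mem_block_of_commute hL fun k => ?_
  have hb := D.commute_hamiltonian_logical k
  have hX := fun j hj => D.commute_snake_logical (j := j) hj k
  have hZ := fun j hj => D.commute_comb_logical (j := j) hj k
  rw [Commute, SemiconjBy, ← D.genLocal_mul_left β hb hX hZ, ← D.genLocal_mul_right β hb hX hZ,
    (D.commute_logical_of_mem_block hA k).eq]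

theorem davies_conj {H S U : Op L} (hH : Commute H U) (hS : CommOrAnti S U)
    (hSh : S.IsHermitian) (β : ℝ) (T : Op L) :
    davies H β S (U * T * U) = U * davies H β S T * U := by
  rcases hS with h | h
  · rw [davies_mul_right hH h hSh, davies_mul_left hH h hSh]
  · exact davies_conj_anticomm hH h hSh β T

theorem commOrAnti_onSites_logical (j : Edge L) (k : Fin 2 ⊕ Fin 2) :
    CommOrAnti (onSites {j} pauliX) (D.logical k) ∧ CommOrAnti (onSites {j} pauliY) (D.logical k) ∧
      CommOrAnti (onSites {j} pauliZ) (D.logical k) := by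
  have symm : ∀ {U T : Op L}, CommOrAnti U T → CommOrAnti T U := by
    intro U T h
    rcases h with h | h
    · exact Or.inl h.symm
    · exact Or.inr (by rw [h, neg_neg])
  have hX := (D.commOrAnti_logical_pauli k (ind {j}) (ind {j})).1
  have hZ := (D.commOrAnti_logical_pauli k (ind {j}) (ind {j})).2
  rw [← onSites_eq_pauli] at hX hZ
  refine ⟨symm hX, symm ?_, symm hZ⟩
  rw [onSites_pauliY]
  exact (hX.mul hZ).smul _

theorem commOrAnti_logical (k l : Fin 2 ⊕ Fin 2) : CommOrAnti (D.logical k) (D.logical l) := by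
  rcases l with i | i
  · change CommOrAnti _ (D.logX i)
    rw [logX_eq]
    exact (D.commOrAnti_logical_pauli k _ 0).1
  · change CommOrAnti _ (D.logZ i)
    rw [logZ_eq]
    exact (D.commOrAnti_logical_pauli k 0 _).2

/-- Conjugation by a logical operator sends every coupling to plus or minus itself, and the sign
drops out of the dissipator. This holds also for couplings off the snake and comb. -/
theorem genFull_conj (k : Fin 2 ⊕ Fin 2) (T : Op L) :
    D.genFull β (D.logical k * T * D.logical k) =
      D.logical k * D.genFull β T * D.logical k := by
  have hH := D.commute_hamiltonian_logical k
  simp only [genFull_eq, genSites, genGlobal_eq, LinearMap.add_apply, LinearMap.sum_apply, mul_add,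
    add_mul, Finset.mul_sum, Finset.sum_mul]
  congr 1
  · refine Finset.sum_congr rfl fun j _ => ?_
    obtain ⟨hX, hY, hZ⟩ := D.commOrAnti_onSites_logical j k
    rw [davies_conj hH hX (isHermitian_onSites isHermitian_pauliX _),
      davies_conj hH hY (isHermitian_onSites isHermitian_pauliY _),
      davies_conj hH hZ (isHermitian_onSites isHermitian_pauliZ _)]
  · exact Finset.sum_congr rfl fun l _ =>
      davies_conj hH (D.commOrAnti_logical l k) (D.isHermitian_logical l) β T

/-- The kernel of the snake-and-comb generator on the trivial block consists of the scalars. -/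
theorem eq_smul_one_of_genLocal_eq_zero (hL : 2 ≤ L) {A : Op L} (hA : A ∈ D.block .I .I)
    (h : D.genLocal β A = 0) : ∃ c : ℂ, A = c • 1 := by
  have h0 : (gnsInner (ρ β) A ((-D.genLocal β) A)).re = 0 := by
    rw [LinearMap.neg_apply, h]
    simp [gnsInner]
  have hX' : ∀ j ∈ D.snake, GNSNonneg (ρ β) (-davies (hamiltonian L) β (onSites {j} pauliX)) :=
    fun _ _ => gnsNonneg_onSites β isHermitian_pauliX _
  have hZ' : ∀ j ∈ D.comb, GNSNonneg (ρ β) (-davies (hamiltonian L) β (onSites {j} pauliZ)) :=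
    fun _ _ => gnsNonneg_onSites β isHermitian_pauliZ _
  rw [genLocal, neg_add, ← Finset.sum_neg_distrib, ← Finset.sum_neg_distrib,
    LinearMap.add_apply, gnsInner_add, Complex.add_re] at h0
  have hX0 := (GNSNonneg.sum hX').2 A
  have hZ0 := (GNSNonneg.sum hZ').2 A
  have hX : ∀ j ∈ D.snake, Commute (onSites {j} pauliX) A ∧ Commute (hamiltonian L *
      onSites {j} pauliX - onSites {j} pauliX * hamiltonian L) A := fun j hj =>
    commute_of_re_gnsInner_davies_eq_zero isHermitian_hamiltonian
      (isHermitian_onSites isHermitian_pauliX _) (β := β) (le_antisymm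
        ((GNSNonneg.single_le_sum hX' hj A).trans (by linarith)) ((hX' j hj).2 A))
  have hZ : ∀ j ∈ D.comb, Commute (onSites {j} pauliZ) A ∧ Commute (hamiltonian L *
      onSites {j} pauliZ - onSites {j} pauliZ * hamiltonian L) A := fun j hj =>
    commute_of_re_gnsInner_davies_eq_zero isHermitian_hamiltonian
      (isHermitian_onSites isHermitian_pauliZ _) (β := β) (le_antisymm
        ((GNSNonneg.single_le_sum hZ' hj A).trans (by linarith)) ((hZ' j hj).2 A))
  have hlog := D.commute_logical_of_mem_block hA
  -- Edge operators commute with `A` by the vanishing form, stars and plaquettes by connectedness,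
  -- loops because `A` is in the trivial block; together they generate all Pauli operators.
  refine eq_smul_one_of_commute (commute_pauli_of_span pauliX_mul_self
    (D.span_pauliX_generators hL) ?_) (commute_pauli_of_span pauliZ_mul_self
    (D.span_pauliZ_generators hL) ?_)
  · rintro _ ((⟨k, hk, rfl⟩ | ⟨p, rfl⟩) | ⟨k, rfl⟩) <;> beta_reduce <;> rw [← onSites_eq_pauli]
    · exact (hX k hk).1
    · exact commute_star_of_connected hL D.comb_connected (fun j hj => (hZ j hj).1)
        (fun j hj => (hZ j hj).2) p
    · exact hlog (Sum.inl k)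
  · rintro _ ((⟨k, hk, rfl⟩ | ⟨p, rfl⟩) | ⟨k, rfl⟩) <;> beta_reduce <;> rw [← onSites_eq_pauli]
    · exact (hZ k hk).1
    · exact commute_plaq_of_connected hL D.snake_connected (fun j hj => (hX j hj).1)
        (fun j hj => (hX j hj).2) p
    · exact hlog (Sum.inr k)

/-- It anticommutes with `σˣ` on one of its edges, which forces such a scalar to be zero, but its
square is one. -/
theorem onSites_ne_smul_one {p : Node L} (c : ℂ) : onSites (plaq p) pauliZ ≠ c • 1 := by
  intro h
  have h1 : onSites (plaq p) pauliZ * onSites {Sum.inl p} pauliX =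
      -(onSites {Sum.inl p} pauliX * onSites (plaq p) pauliZ) := by
    simp only [onSites_eq_pauli, ind_singleton]
    rw [pauliZ_pauliX, dotProduct_single_one, ind, if_pos (by simp [plaq]), sgn_one, neg_one_smul]
  have h2 := onSites_mul_self pauliZ_mul_self (plaq p)
  rw [h, smul_mul_assoc, mul_smul_comm, one_mul, mul_one] at h1
  have h3 : (2 * c) • onSites {Sum.inl p} pauliX = 0 := by
    rw [two_mul, add_smul]
    nth_rw 1 [h1]
    exact neg_add_cancel _
  have h4 := congrArg (fun T => T * onSites {Sum.inl p} pauliX) h3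
  simp only [smul_mul_assoc, onSites_mul_self pauliX_mul_self, zero_mul, smul_eq_zero,
    one_ne_zero, or_false, mul_eq_zero, two_ne_zero, false_or] at h4
  rw [h, h4, zero_smul, zero_mul] at h2
  exact zero_ne_one h2

/-- A plaquette operator lies in the block and is not a scalar, hence not in the kernel. -/
theorem posEigenvalues_genLocal_nonempty (hL : 2 ≤ L) :
    (posEigenvalues (-D.genLocal β) (D.block .I .I)).Nonempty := by
  have hmem : onSites (plaq (0 : Node L)) pauliZ ∈ D.block .I .I :=
    D.mem_block_I.2 (Submodule.subset_span
      ⟨_, Algebra.subset_adjoin (Or.inl ⟨0, rfl⟩), 1, one_mem _, (mul_one _).symm⟩)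
  refine GNSNonneg.posEigenvalues_nonempty isHermitian_hamiltonian (D.gnsNonneg_genLocal β)
    (fun A hA => Submodule.neg_mem _ (D.genLocal_mem_block β hL hA)) hmem fun h => ?_
  rw [LinearMap.neg_apply, neg_eq_zero] at h
  obtain ⟨c, hc⟩ := D.eq_smul_one_of_genLocal_eq_zero β hL hmem h
  exact onSites_ne_smul_one c hc

theorem gapOn_genLocal_pos (hL : 2 ≤ L) : 0 < gapOn (-D.genLocal β) (D.block .I .I) :=
  (gapOn_mem (D.posEigenvalues_genLocal_nonempty β hL)).1

/-- The global generator is bounded below by `2` on operators that anticommute with a logical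
operator. -/
theorem two_mul_le_genGlobal {k : Fin 2 ⊕ Fin 2} {A : Op L}
    (h : D.logical k * A * D.logical k = -A) :
    2 * (gnsInner (ρ β) A A).re ≤ (gnsInner (ρ β) A ((-D.genGlobal β) A)).re := by
  rw [genGlobal_eq, ← Finset.sum_neg_distrib]
  refine le_trans (le_of_eq ?_) (GNSNonneg.single_le_sum
    (fun k _ => D.gnsNonneg_logical β k) (Finset.mem_univ k) A)
  rw [LinearMap.neg_apply, davies_logical, h,
    show -(-A - A) = ((2 : ℝ) : ℂ) • A by push_cast; rw [two_smul]; abel, gnsInner_smul,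
    Complex.re_ofReal_mul]

theorem two_mul_le_genFull {k : Fin 2 ⊕ Fin 2} {A : Op L}
    (h : D.logical k * A * D.logical k = -A) :
    2 * (gnsInner (ρ β) A A).re ≤ (gnsInner (ρ β) A ((-D.genFull β) A)).re := by
  rw [genFull_eq, neg_add, LinearMap.add_apply, gnsInner_add, Complex.add_re]
  have := D.two_mul_le_genGlobal β h
  have := (gnsNonneg_genSites β).2 A
  linarith

theorem genLocal_le_genFull (A : Op L) :
    (gnsInner (ρ β) A ((-D.genLocal β) A)).re ≤ (gnsInner (ρ β) A ((-D.genFull β) A)).re := by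
  have h : -D.genFull β = -D.genLocal β + ((D.genLocal β - genSites β) + -D.genGlobal β) := by
    rw [genFull_eq]; abel
  rw [h, LinearMap.add_apply, gnsInner_add, Complex.add_re]
  have := ((D.gnsNonneg_genLocal_sub_genSites β).add (D.gnsNonneg_genGlobal β)).2 A
  linarith

end Layout

/-! ### Nontrivial blocks and the Gibbs sampler. -/

namespace Layout

variable (D : Layout L) (β : ℝ)

local notation "ρ" => gibbsState (hamiltonian L)

theorem commOrAnti_logical_logOp (k : Fin 2 ⊕ Fin 2) (i : Fin 2) (B : Label) :
    CommOrAnti (D.logical k) (D.logOp i B) := by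
  cases B with
  | I => exact Or.inl (Commute.one_right _)
  | X => exact D.commOrAnti_logical k (Sum.inl i)
  | Y => exact ((D.commOrAnti_logical k (Sum.inr i)).mul (D.commOrAnti_logical k (Sum.inl i))).smul _
  | Z => exact D.commOrAnti_logical k (Sum.inr i)

theorem commute_logOp_of_commute {T : Op L} {i : Fin 2} (hX : Commute T (D.logX i))
    (hZ : Commute T (D.logZ i)) (B : Label) : Commute T (D.logOp i B) := by
  cases B with
  | I => exact Commute.one_right _
  | X => exact hX
  | Y => exact (hZ.mul_right hX).smul_right _
  | Z => exact hZ

theorem logZ_mul_logX (i k : Fin 2) :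
    D.logZ k * D.logX i = sgn (if i = k then 1 else 0) • (D.logX i * D.logZ k) := by
  rw [logZ_eq, logX_eq, pauliZ_pauliX, dotProduct_comm, loopX_dotProduct_loopZ]

theorem commute_logX_logX (i k : Fin 2) : Commute (D.logX i) (D.logX k) := by
  rw [logX_eq, logX_eq]
  exact pauli_commute pauliX_mul_self _ _

theorem commute_logZ_logZ (i k : Fin 2) : Commute (D.logZ i) (D.logZ k) := by
  rw [logZ_eq, logZ_eq]
  exact pauli_commute pauliZ_mul_self _ _

theorem commute_logX_logZ {i k : Fin 2} (h : i ≠ k) : Commute (D.logX i) (D.logZ k) := by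
  rw [Commute, SemiconjBy, logZ_mul_logX, if_neg h, sgn_zero, one_smul]

theorem logZ_mul_logX_self (i : Fin 2) : D.logZ i * D.logX i = -(D.logX i * D.logZ i) := by
  rw [logZ_mul_logX, if_pos rfl, sgn_one, neg_one_smul]

/-- A nontrivial logical label anticommutes with a logical operator that commutes with the logical
operators of the other pair. -/
theorem exists_logical_anticomm (i : Fin 2) {B : Label} (hB : B ≠ .I) :
    ∃ k, D.logical k * D.logOp i B = -(D.logOp i B * D.logical k) ∧
      ∀ i', i' ≠ i → ∀ B', Commute (D.logical k) (D.logOp i' B') := by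
  have hz : ∀ i', i' ≠ i → ∀ B', Commute (D.logical (Sum.inr i)) (D.logOp i' B') :=
    fun i' h B' => D.commute_logOp_of_commute (D.commute_logX_logZ h).symm
      (D.commute_logZ_logZ _ _) B'
  have hx : ∀ i', i' ≠ i → ∀ B', Commute (D.logical (Sum.inl i)) (D.logOp i' B') :=
    fun i' h B' => D.commute_logOp_of_commute (D.commute_logX_logX _ _)
      (D.commute_logX_logZ h.symm) B'
  have h := D.logZ_mul_logX_self i
  cases B with
  | I => exact absurd rfl hB
  | X => exact ⟨Sum.inr i, h, hz⟩
  | Y =>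
    refine ⟨Sum.inr i, ?_, hz⟩
    change D.logZ i * (-Complex.I • (D.logZ i * D.logX i)) =
      -((-Complex.I • (D.logZ i * D.logX i)) * D.logZ i)
    rw [mul_smul_comm, smul_mul_assoc, ← smul_neg, mul_assoc (D.logZ i) (D.logX i), ← mul_neg, h]
  | Z => exact ⟨Sum.inl i, by change D.logX i * D.logZ i = -(D.logZ i * D.logX i); rw [h, neg_neg],
      hx⟩

/-- The logical prefactor is the same for all spanning elements and can be pulled out of linear
combinations, so the whole block has one sign under each logical operator. -/
theorem mem_block_iff {B₁ B₂ : Label} {T : Op L} : T ∈ D.block B₁ B₂ ↔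
    ∃ Q ∈ D.block .I .I, T = D.logOp 0 B₁ * D.logOp 1 B₂ * Q := by
  constructor
  · intro hT
    induction hT using Submodule.span_induction with
    | mem x hx =>
      obtain ⟨a, ha, e, he, rfl⟩ := hx
      exact ⟨a * e, D.mem_block_I.2 (Submodule.subset_span ⟨a, ha, e, he, rfl⟩), rfl⟩
    | zero => exact ⟨0, Submodule.zero_mem _, by simp⟩
    | add x y _ _ hx hy =>
      obtain ⟨Q, hQ, rfl⟩ := hx
      obtain ⟨Q', hQ', rfl⟩ := hy
      exact ⟨Q + Q', Submodule.add_mem _ hQ hQ', by rw [mul_add]⟩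
    | smul c x _ hx =>
      obtain ⟨Q, hQ, rfl⟩ := hx
      exact ⟨c • Q, Submodule.smul_mem _ c hQ, by rw [mul_smul_comm]⟩
  · rintro ⟨Q, hQ, rfl⟩
    rw [mem_block_I] at hQ
    induction hQ using Submodule.span_induction with
    | mem x hx =>
      obtain ⟨a, ha, e, he, rfl⟩ := hx
      exact Submodule.subset_span ⟨a, ha, e, he, rfl⟩
    | zero => simp
    | add x y _ _ hx hy => rw [mul_add]; exact Submodule.add_mem _ hx hy
    | smul c x _ hx => rw [mul_smul_comm]; exact Submodule.smul_mem _ c hx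

theorem logical_conj_block {b Q : Op L} (hQ : Q ∈ D.block .I .I) (k : Fin 2 ⊕ Fin 2) :
    (D.logical k * b = b * D.logical k → D.logical k * (b * Q) * D.logical k = b * Q) ∧
      (D.logical k * b = -(b * D.logical k) →
        D.logical k * (b * Q) * D.logical k = -(b * Q)) := by
  have hc := (D.commute_logical_of_mem_block hQ k).eq
  have h2 := D.logical_mul_self k
  constructor <;> intro h
  · rw [← mul_assoc, h, mul_assoc b, hc, mul_assoc, mul_assoc, h2, mul_one]
  · rw [← mul_assoc, h, neg_mul, mul_assoc b, hc, neg_mul, mul_assoc, mul_assoc, h2, mul_one]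

/-- The local part passes through the logical prefactor and acts on the trivial block; each global
term acts on the block as a scalar, `0` or `-2`. -/
theorem genGapped_mem_block (hL : 2 ≤ L) {B₁ B₂ : Label} {A : Op L} (hA : A ∈ D.block B₁ B₂) :
    D.genGapped β A ∈ D.block B₁ B₂ := by
  obtain ⟨Q, hQ, rfl⟩ := D.mem_block_iff.1 hA
  have hcomm : ∀ {T : Op L}, (∀ k, Commute T (D.logical k)) →
      Commute T (D.logOp 0 B₁ * D.logOp 1 B₂) := fun h =>
    (D.commute_logOp_of_commute (h (Sum.inl 0)) (h (Sum.inr 0)) B₁).mul_right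
      (D.commute_logOp_of_commute (h (Sum.inl 1)) (h (Sum.inr 1)) B₂)
  rw [genGapped, LinearMap.add_apply, D.genLocal_mul_left β
    (hcomm D.commute_hamiltonian_logical) (fun j hj => hcomm (D.commute_snake_logical hj))
    (fun j hj => hcomm (D.commute_comb_logical hj)), genGlobal_eq, LinearMap.sum_apply]
  refine Submodule.add_mem _ (D.mem_block_iff.2 ⟨_, D.genLocal_mem_block β hL hQ, rfl⟩)
    (Submodule.sum_mem _ fun k _ => ?_)
  rw [davies_logical]
  refine Submodule.sub_mem _ ?_ hA
  rcases (D.commOrAnti_logical_logOp k 0 B₁).mul (D.commOrAnti_logical_logOp k 1 B₂) with h | h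
  · rw [(D.logical_conj_block hQ k).1 h]
    exact hA
  · rw [(D.logical_conj_block hQ k).2 h]
    exact Submodule.neg_mem _ hA

theorem exists_logical_conj_eq_neg {B₁ B₂ : Label} (hB : B₁ ≠ .I ∨ B₂ ≠ .I) {A : Op L}
    (hA : A ∈ D.block B₁ B₂) : ∃ k, D.logical k * A * D.logical k = -A := by
  obtain ⟨Q, hQ, rfl⟩ := D.mem_block_iff.1 hA
  rcases hB with hB | hB
  · obtain ⟨k, hk, hk'⟩ := D.exists_logical_anticomm 0 hB
    refine ⟨k, (D.logical_conj_block hQ k).2 ?_⟩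
    rw [← mul_assoc, hk, neg_mul, mul_assoc, (hk' 1 (by simp) B₂).eq, mul_assoc]
  · obtain ⟨k, hk, hk'⟩ := D.exists_logical_anticomm 1 hB
    refine ⟨k, (D.logical_conj_block hQ k).2 ?_⟩
    rw [← mul_assoc, (hk' 0 (by simp) B₁).eq, mul_assoc, hk, mul_neg, mul_assoc]

/-- On the nontrivial blocks the gapped generator is bounded below by any constant up to `2`. -/
theorem boundedBelowOn_genGapped (hL : 2 ≤ L) {B₁ B₂ : Label} (hB : B₁ ≠ .I ∨ B₂ ≠ .I) {c : ℝ}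
    (hc : c ≤ 2) : BoundedBelowOn (ρ β) (-D.genGapped β) (D.block B₁ B₂) c := by
  refine ⟨fun A hA => Submodule.neg_mem _ (D.genGapped_mem_block β hL hA), fun A hA => ?_⟩
  obtain ⟨k, hk⟩ := D.exists_logical_conj_eq_neg hB hA
  have e : gnsInner (ρ β) A ((-D.genGapped β) A - (c : ℂ) • A) =
      gnsInner (ρ β) A ((-D.genLocal β + -D.genGlobal β) A) - (c : ℂ) * gnsInner (ρ β) A A := by
    rw [genGapped, neg_add, sub_eq_add_neg, ← neg_smul, gnsInner_add, gnsInner_smul]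
    ring
  have hA0 := re_gnsInner_self_nonneg isHermitian_hamiltonian β A
  have him : (gnsInner (ρ β) A A).im = 0 := by
    by_cases h : A = 0
    · simp [h, gnsInner]
    · exact (gnsInner_self_pos isHermitian_hamiltonian β h).2
  rw [e]
  constructor
  · rw [Complex.sub_re, Complex.re_ofReal_mul, LinearMap.add_apply, gnsInner_add, Complex.add_re]
    have h1 := D.two_mul_le_genGlobal β hk
    have h2 := (D.gnsNonneg_genLocal β).2 A
    nlinarith
  · rw [Complex.sub_im, Complex.im_ofReal_mul, him, mul_zero, sub_zero]
    exact GNSNonneg.im_eq_zero isHermitian_hamiltonian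
      ((D.gnsNonneg_genLocal β).add (D.gnsNonneg_genGlobal β)) A

theorem le_of_genFull_eq_smul {r : ℝ} {x : Op L} (hx : (-D.genFull β) x = (r : ℂ) • x) {m : ℝ}
    (hx0 : x ≠ 0) (h : m * (gnsInner (ρ β) x x).re ≤ (gnsInner (ρ β) x ((-D.genFull β) x)).re) :
    m ≤ r := by
  rw [hx, gnsInner_smul, Complex.re_ofReal_mul] at h
  exact le_of_mul_le_mul_right h (gnsInner_self_pos isHermitian_hamiltonian β hx0).1

/-- The positive eigenvalues of the Gibbs sampler are at least `2` or at least the gap of the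
snake-and-comb generator on the trivial block. -/
theorem le_of_mem_posEigenvalues (hL : 2 ≤ L) {r : ℝ}
    (hr : r ∈ posEigenvalues (-D.genFull β) ⊤) :
    2 ≤ r ∨ gapOn (-D.genLocal β) (D.block .I .I) ≤ r := by
  obtain ⟨hr0, x, -, hx0, hx⟩ := hr
  by_cases hc : ∀ k, Commute (D.logical k) x
  · right
    have hxm := D.mem_block_of_commute hL hc
    -- Eigenvectors of a symmetric operator for the eigenvalues `0` and `r ≠ 0` are orthogonal.
    have h1 : gnsInner (ρ β) 1 x = 0 := by
      have h := (D.gnsNonneg_genFull β).1 1 x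
      have h0 : (-D.genFull β) 1 = 0 := by
        simp [genFull_eq, genSites, genGlobal_eq, davies_one]
      rw [h0, hx, gnsInner_smul] at h
      have h' : (r : ℂ) * gnsInner (ρ β) 1 x = 0 := h.symm.trans (by simp [gnsInner])
      exact (mul_eq_zero.1 h').resolve_left (by exact_mod_cast hr0.ne')
    refine D.le_of_genFull_eq_smul β hx hx0 (le_trans ?_ (D.genLocal_le_genFull β x))
    refine GNSNonneg.gapOn_mul_le isHermitian_hamiltonian (D.gnsNonneg_genLocal β)
      (fun A hA => Submodule.neg_mem _ (D.genLocal_mem_block β hL hA)) hxm fun z hz hz0 => ?_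
    rw [LinearMap.neg_apply, neg_eq_zero] at hz0
    obtain ⟨c, rfl⟩ := D.eq_smul_one_of_genLocal_eq_zero β hL hz hz0
    have : gnsInner (ρ β) (c • 1) x = starRingEnd ℂ c * gnsInner (ρ β) 1 x := by
      simp [gnsInner]
    rw [this, h1, mul_zero]
  · left
    push Not at hc
    obtain ⟨k, hk⟩ := hc
    have h2 := D.logical_mul_self k
    -- The odd part of `x` under conjugation is nonzero because `x` fails to commute, and it is
    -- again an eigenvector for `r`.
    have hy0 : x - D.logical k * x * D.logical k ≠ 0 := by
      intro h
      apply hk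
      have := congrArg (fun T => T * D.logical k) (sub_eq_zero.1 h)
      simp only [mul_assoc, h2, mul_one] at this
      exact this.symm
    have hy : (-D.genFull β) (x - D.logical k * x * D.logical k) =
        (r : ℂ) • (x - D.logical k * x * D.logical k) := by
      have hc := D.genFull_conj β k x
      have hx' : D.genFull β x = -((r : ℂ) • x) := by rw [← hx, LinearMap.neg_apply, neg_neg]
      rw [map_sub, hx, LinearMap.neg_apply, hc, hx', smul_sub]
      simp only [mul_neg, neg_mul, neg_neg, mul_smul_comm, smul_mul_assoc]
    refine D.le_of_genFull_eq_smul β hy hy0 (D.two_mul_le_genFull β (k := k) ?_)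
    rw [mul_sub, sub_mul, neg_sub]
    congr 1
    rw [← mul_assoc, ← mul_assoc, h2, one_mul, mul_assoc, h2, mul_one]

/-- The logical operator `X` of the first pair is odd under its partner `Z`, so its form is positive
and the generator does not kill it. -/
theorem posEigenvalues_genFull_nonempty :
    (posEigenvalues (-D.genFull β) ⊤).Nonempty := by
  have hc : D.logical (Sum.inr 0) * D.logX 0 * D.logical (Sum.inr 0) = -D.logX 0 := by
    change D.logZ 0 * D.logX 0 * D.logZ 0 = _
    rw [D.logZ_mul_logX_self 0, neg_mul, mul_assoc]
    rw [show D.logZ 0 * D.logZ 0 = 1 from D.logical_mul_self (Sum.inr 0), mul_one]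
  have hne : D.logX 0 ≠ 0 := by
    intro h
    have h2 : D.logX 0 * D.logX 0 = 1 := D.logical_mul_self (Sum.inl 0)
    rw [h, mul_zero] at h2
    exact zero_ne_one h2
  refine GNSNonneg.posEigenvalues_nonempty isHermitian_hamiltonian (D.gnsNonneg_genFull β)
    (fun _ _ => Submodule.mem_top) (Submodule.mem_top (x := D.logX 0)) fun h => ?_
  have h1 := D.two_mul_le_genFull β hc
  rw [h] at h1
  have h2 := (gnsInner_self_pos isHermitian_hamiltonian β hne).1
  have h3 : gnsInner (ρ β) (D.logX 0) 0 = 0 := by simp [gnsInner]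
  rw [h3, Complex.zero_re] at h1
  linarith

end Layout

end Toric

/-! ### Choice of the constant. -/

theorem mainTheorem5 (C : ℝ) :
    ∃ c : ℝ, 0 < c ∧ ∀ (L : ℕ) [NeZero L], 2 ≤ L → ∀ (D : Toric.Layout L) (β : ℝ), 0 < β →
      (∀ A ∈ D.block .I .I, D.genLocal β A ∈ D.block .I .I) ∧
      0 < gapOn (-D.genLocal β) (D.block .I .I) ∧
      (gapOn (-D.genLocal β) (D.block .I .I) ≤ C →
        (∀ B₁ B₂ : Toric.Label, B₁ ≠ .I ∨ B₂ ≠ .I →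
          BoundedBelowOn (gibbsState (Toric.hamiltonian L) β) (-D.genGapped β) (D.block B₁ B₂)
            (c * gapOn (-D.genLocal β) (D.block .I .I))) ∧
        c * gapOn (-D.genLocal β) (D.block .I .I) ≤ gapOn (-D.genFull β) ⊤) := by
  have hm : 0 < max C 1 := lt_max_of_lt_right one_pos
  -- The entry `1` serves eigenvalues bounded by `g`, the entry `2 / max C 1` those bounded by `2`.
  -- The maximum with `1` keeps the denominator positive for every real `C`.
  refine ⟨min 1 (2 / max C 1), lt_min one_pos (by positivity), ?_⟩
  intro L _ hL D β _
  have hg := D.gapOn_genLocal_pos β hL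
  refine ⟨fun A hA => D.genLocal_mem_block β hL hA, hg, fun hC => ?_⟩
  set g := gapOn (-D.genLocal β) (D.block .I .I)
  have h2 : min 1 (2 / max C 1) * g ≤ 2 :=
    calc min 1 (2 / max C 1) * g ≤ 2 / max C 1 * max C 1 :=
          mul_le_mul (min_le_right _ _) (hC.trans (le_max_left _ _)) hg.le (by positivity)
      _ = 2 := div_mul_cancel₀ _ hm.ne'
  have h1 : min 1 (2 / max C 1) * g ≤ g := mul_le_of_le_one_left hg.le (min_le_left _ _)
  refine ⟨fun B₁ B₂ hB => D.boundedBelowOn_genGapped β hL hB h2, ?_⟩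
  refine le_csInf (D.posEigenvalues_genFull_nonempty β) fun r hr => ?_
  rcases D.le_of_mem_posEigenvalues β hL hr with h | h
  · exact h2.trans h
  · exact h1.trans h
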